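/- **Theorem.** Assume the Strong Exponential Time Hypothesis (SETH): for every real $\delta<1$ there is a $k$ such that no algorithm decides the satisfiability of $k$-CNF formulas with $n$ variables and $m$ clauses in time $2^{\delta n}(n+m)^{O(1)}$. Then for no $\varepsilon>0$ (with $\varepsilon<2$, so that the bound is positive) is there an algorithm for Max Bisection that runs in time $(2-\varepsilon)^{t}\,n^{O(1)}$, even if a tree decomposition of the input graph is given as part of the input; here $n$ is the number of vertices of the input graph and $t$ is the width of the given decomposition. This holds even if the algorithm is only required to work when all edge weights are $1$ and the given decomposition has at most $n$ nodes. *Definitions.* In Max Bisection one is given a simple undirected graph $G=(V,E)$ with non-negative edge weights $w$, and one has to output a maximum size bisection of $G$: a bipartition $(A,B)$ of $V$ with $-1\le |A|-|B|\le 1$ that maximizes the total weight $w(A,B)$ of the edges between $A$ and $B$. A tree decomposition of $G$ is a rooted tree $T$ with node set $I$ and sets $X_i\subseteq V$ ($i\in I$) such that $\bigcup_i X_i=V$, each edge of $G$ is contained in some $X_i$, and for each $v\in V$ the set $\{i\in I: v\in X_i\}$ induces a connected subgraph of $T$; its width is $\max_i|X_i|-1$. Algorithms, in SETH and in the conclusion,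 are deterministic list-processing programs (programs with loops and conditionals over variables that hold binary trees), in which each of the operations cons, head, tail, copy and test for nil takes one step; up to polylogarithmic factors this is the running time of a random access machine with logarithmic cost. -/

import Mathlib

namespace BisectionHardness

/-! ## Machine model

Deterministic list-processing programs (the `WHILE` language over binary trees, i.e. pure Lisp as a
pointer machine). A variable holds a binary tree; `cons`, `hd`, `tl`, copying, and the test for
`nil` cost one step each, and there is no other primitive. A pointer implementation and a binary
trie for the memory show that this model and the RAM with logarithmic cost simulate each other with
polylogarithmic overhead, so that bounds of the form `2 ^ (a * n) * poly` mean the same in both. -/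

/-- Binary trees: the data of programs. -/
inductive Val : Type
  | nil : Val
  | cons : Val → Val → Val

namespace Val

/-- Head of a cell; `nil` has head `nil`. -/
def hd : Val → Val
  | nil => nil
  | cons a _ => a

/-- Tail of a cell; `nil` has tail `nil`. -/
def tl : Val → Val
  | nil => nil
  | cons _ b => b

/-- `true` is a cell, `false` is `nil`. -/
def ofBool : Bool → Val
  | true => cons nil nil
  | false => nil

/-- Lists as right-nested cells. -/
def ofList : List Val → Val
  | [] => nil
  | a :: l => cons a (ofList l)

/-- Unary numerals, used for indices (of variables, vertices, nodes). -/
def ofNat : ℕ → Val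
  | 0 => nil
  | n + 1 => cons nil (ofNat n)

/-- Binary numerals, least significant bit first, used for edge weights. -/
def ofNatBinary (n : ℕ) : Val := ofList (n.bits.map ofBool)

end Val

/-- A store assigns a tree to every variable. -/
abbrev Store : Type := ℕ → Val

/-- Expressions over the program variables. -/
inductive Expr : Type
  | var : ℕ → Expr
  | nil : Expr
  | cons : Expr → Expr → Expr
  | hd : Expr → Expr
  | tl : Expr → Expr

namespace Expr

/-- Value of an expression. -/
def eval (s : Store) : Expr → Val
  | var x => s x
  | nil => Val.nil
  | cons a b => Val.cons (a.eval s) (b.eval s)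
  | hd a => (a.eval s).hd
  | tl a => (a.eval s).tl

/-- Number of steps for the evaluation: one for every operation or leaf. -/
def cost : Expr → ℕ
  | var _ => 1
  | nil => 1
  | cons a b => a.cost + b.cost + 1
  | hd a => a.cost + 1
  | tl a => a.cost + 1

end Expr

/-- Programs. In `ite e p q` and `loop e p` the test is whether the value of `e` is not `nil`. -/
inductive Prog : Type
  | skip : Prog
  | assign : ℕ → Expr → Prog
  | seq : Prog → Prog → Prog
  | ite : Expr → Prog → Prog → Prog
  | loop : Expr → Prog → Prog

/-- `Exec p s t s'`: started in the store `s`, the program `p` halts after exactly `t` steps in the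
store `s'`. -/
inductive Exec : Prog → Store → ℕ → Store → Prop
  | skip (s : Store) : Exec Prog.skip s 1 s
  | assign (s : Store) (x : ℕ) (e : Expr) :
      Exec (Prog.assign x e) s (e.cost + 1) (Function.update s x (e.eval s))
  | seq {p q : Prog} {s s₁ s₂ : Store} {t₁ t₂ : ℕ} :
      Exec p s t₁ s₁ → Exec q s₁ t₂ s₂ → Exec (Prog.seq p q) s (t₁ + t₂) s₂
  | iteTrue {e : Expr} {p q : Prog} {s s₁ : Store} {t : ℕ} :
      e.eval s ≠ Val.nil → Exec p s t s₁ → Exec (Prog.ite e p q) s (e.cost + 1 + t) s₁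
  | iteFalse {e : Expr} {p q : Prog} {s s₁ : Store} {t : ℕ} :
      e.eval s = Val.nil → Exec q s t s₁ → Exec (Prog.ite e p q) s (e.cost + 1 + t) s₁
  | loopDone {e : Expr} {p : Prog} {s : Store} :
      e.eval s = Val.nil → Exec (Prog.loop e p) s (e.cost + 1) s
  | loopStep {e : Expr} {p : Prog} {s s₁ s₂ : Store} {t₁ t₂ : ℕ} :
      e.eval s ≠ Val.nil → Exec p s t₁ s₁ → Exec (Prog.loop e p) s₁ t₂ s₂ →
        Exec (Prog.loop e p) s (e.cost + 1 + t₁ + t₂) s₂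

/-- The input is in variable `0`, all other variables are `nil`. -/
def initStore (x : Val) : Store := Function.update (fun _ => Val.nil) 0 x

/-- On input `x` the program halts within `T` steps, with output `y` in variable `0`. -/
def OutputsWithin (p : Prog) (x y : Val) (T : ℝ) : Prop :=
  ∃ (t : ℕ) (s : Store), Exec p (initStore x) t s ∧ s 0 = y ∧ (t : ℝ) ≤ T

/-! ## Satisfiability and the Strong Exponential Time Hypothesis -/

/-- A literal over `n` variables: the variable, and the truth value that satisfies the literal. -/
abbrev Literal (n : ℕ) : Type := Fin n × Bool

/-- A clause is a disjunction of literals. -/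
abbrev Clause (n : ℕ) : Type := List (Literal n)

/-- A formula in conjunctive normal form. -/
abbrev CNF (n : ℕ) : Type := List (Clause n)

namespace CNF

/-- Every clause has at most `k` literals. -/
def HasWidth {n : ℕ} (k : ℕ) (φ : CNF n) : Prop := ∀ c ∈ φ, c.length ≤ k

/-- Some assignment satisfies a literal in every clause. -/
def Satisfiable {n : ℕ} (φ : CNF n) : Prop :=
  ∃ a : Fin n → Bool, ∀ c ∈ φ, ∃ l ∈ c, a l.1 = l.2

/-- The formula as program input. -/
def encode {n : ℕ} (φ : CNF n) : Val :=
  Val.cons (Val.ofNat n) (Val.ofList (φ.map fun c =>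
    Val.ofList (c.map fun l => Val.cons (Val.ofBool l.2) (Val.ofNat l.1))))

end CNF

open Classical in
/-- `k`-SAT with `n` variables and `m` clauses is decided in time `2 ^ (δ * n) * (n + m) ^ O(1)`. -/
def KSatSolvable (k : ℕ) (δ : ℝ) : Prop :=
  ∃ (p : Prog) (C c : ℕ), ∀ (n : ℕ) (φ : CNF n), φ.HasWidth k →
    OutputsWithin p φ.encode (Val.ofBool (decide φ.Satisfiable))
      (C * (2 : ℝ) ^ (δ * n) * ((n + φ.length + 1 : ℕ) : ℝ) ^ c)

/-- The Strong Exponential Time Hypothesis: for every `δ < 1` there is a `k` such that `k`-SAT on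
`n` variables cannot be decided in time `2 ^ (δ * n)`, up to polynomial factors. -/
def SETH : Prop := ∀ δ : ℝ, δ < 1 → ∃ k : ℕ, ¬ KSatSolvable k δ

/-! ## Bisections -/

section Graph

variable {V : Type} [Fintype V] [DecidableEq V]

open Classical in
/-- `E(X, Y)`: the edges of `G` with one end in `X` and the other end in `Y`. -/
noncomputable def edgesBetween (G : SimpleGraph V) (X Y : Finset V) : Finset (Sym2 V) :=
  Finset.univ.filter fun e => e ∈ G.edgeSet ∧ ∃ x ∈ X, ∃ y ∈ Y, e = s(x, y)

/-- `w(X, Y)`: the total weight of the edges between `X` and `Y`. -/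
noncomputable def weightBetween (G : SimpleGraph V) (w : Sym2 V → ℕ) (X Y : Finset V) : ℕ :=
  ∑ e ∈ edgesBetween G X Y, w e

/-- A bipartition `(A, B)` of the vertex set with `-1 ≤ |A| - |B| ≤ 1`. -/
def IsBisection (A B : Finset V) : Prop :=
  IsCompl A B ∧ -1 ≤ (A.card : ℤ) - B.card ∧ (A.card : ℤ) - B.card ≤ 1

/-- A bisection of maximum size. -/
def IsMaxBisection (G : SimpleGraph V) (w : Sym2 V → ℕ) (A B : Finset V) : Prop :=
  IsBisection A B ∧
    ∀ A' B' : Finset V, IsBisection A' B' → weightBetween G w A' B' ≤ weightBetween G w A B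

/-- A tree decomposition of `G` with node set `I`: a rooted tree and a bag for every node. -/
structure TreeDecomposition (G : SimpleGraph V) (I : Type) where
  tree : SimpleGraph I
  isTree : tree.IsTree
  root : I
  bag : I → Finset V
  vertex_covered : ∀ v : V, ∃ i : I, v ∈ bag i
  edge_covered : ∀ u v : V, G.Adj u v → ∃ i : I, u ∈ bag i ∧ v ∈ bag i
  bags_connected : ∀ v : V, (tree.induce {i : I | v ∈ bag i}).Connected

/-- The width `max |X_i| - 1`. (If `G` has a vertex, some bag is nonempty, and the natural number
subtraction is not truncated.) -/
def TreeDecomposition.width {G : SimpleGraph V} {I : Type} [Fintype I]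
    (D : TreeDecomposition G I) : ℕ :=
  (Finset.univ.sup fun i => (D.bag i).card) - 1

end Graph

/-- The list `L` contains every edge of `G` exactly once (in one of its two orientations), and
nothing else. -/
def IsEdgeList {V : Type} (G : SimpleGraph V) (L : List (V × V)) : Prop :=
  (L.map fun p => s(p.1, p.2)).Nodup ∧ ∀ e : Sym2 V, e ∈ (L.map fun p => s(p.1, p.2)) ↔ e ∈ G.edgeSet

/-- An input of Max Bisection: a graph on `n` vertices with edge weights, and a tree decomposition
with `m` nodes. The edges of the graph, the edges of the tree, and the elements of the bags are
given as lists, in any order. (Only the values of `weight` on edges of the graph matter.) -/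
structure MaxBisectionInput where
  n : ℕ
  graph : SimpleGraph (Fin n)
  weight : Sym2 (Fin n) → ℕ
  m : ℕ
  decomp : TreeDecomposition graph (Fin m)
  edgeList : List (Fin n × Fin n)
  isEdgeList : IsEdgeList graph edgeList
  treeEdgeList : List (Fin m × Fin m)
  isTreeEdgeList : IsEdgeList decomp.tree treeEdgeList
  bagList : Fin m → List (Fin n)
  bagList_nodup : ∀ i, (bagList i).Nodup
  mem_bagList : ∀ i v, v ∈ bagList i ↔ v ∈ decomp.bag i

namespace MaxBisectionInput

/-- Every edge of the graph has weight `1`. -/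
def IsUnweighted (J : MaxBisectionInput) : Prop := ∀ e ∈ J.graph.edgeSet, J.weight e = 1

/-- The input as a tree: the number of vertices, the list of weighted edges, the root and the list
of edges of the decomposition tree, and the list of bags. -/
def encode (J : MaxBisectionInput) : Val :=
  Val.ofList [
    Val.ofNat J.n,
    Val.ofList (J.edgeList.map fun p =>
      Val.ofList [Val.ofNat p.1, Val.ofNat p.2, Val.ofNatBinary (J.weight s(p.1, p.2))]),
    Val.ofNat J.decomp.root,
    Val.ofList (J.treeEdgeList.map fun p => Val.cons (Val.ofNat p.1) (Val.ofNat p.2)),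
    Val.ofList (List.ofFn fun i => Val.ofList ((J.bagList i).map fun v => Val.ofNat v))]

end MaxBisectionInput

/-- A cut `(A, V \ A)` as program output: for every vertex in order, whether it belongs to `A`. -/
def encodeSide {n : ℕ} (A : Finset (Fin n)) : Val :=
  Val.ofList (List.ofFn fun v => Val.ofBool (decide (v ∈ A)))

/-- On input `J` the program `p` outputs a maximum size bisection within `T` steps. -/
def SolvesMaxBisection (p : Prog) (J : MaxBisectionInput) (T : ℝ) : Prop :=
  ∃ A : Finset (Fin J.n), IsMaxBisection J.graph J.weight A Aᶜ ∧
    OutputsWithin p J.encode (encodeSide A) T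

end BisectionHardness

namespace BisectionHardness

/-! ## The cut gadgets -/

/-! The proof reduces `k`-SAT on `n` variables to unweighted Max Bisection on a graph of polynomial
size with a path decomposition of width at most `n + 4`. An algorithm with base `2 - ε` would then
solve `k`-SAT, for every `k`, in time `b ^ n` up to polynomial factors, where `b = max (2 - ε) 1 <
2`, against SETH.

The side of a variable vertex, compared with the side of the reference vertex `n`, is its truth
value. The formula is read as a sequence of tokens, one for each literal and one for each end of a
clause. Token gadgets are chained: the gadget with base `c` has the new vertices `c + 1`, `c + 2`,
`c + 3`, and `c + 3` is the base of the next one. The side of a base relative to `n` is a state: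
true only if the current clause already has a true literal.

No gadget has more than four edges in a cut. With exactly four, a literal gadget lets the new state
be true only if the old state or the literal is true, and an end gadget requires the state true and
resets it to false. So a cut with four edges per gadget exists if and only if the formula is
satisfiable (`accepts_of_full`, `exists_full_of_accepts`, `satisfiable_iff_exists_cut`). Enough
isolated vertices are added for every cut of the gadgets to extend to a bisection
(`exists_isBisection`), so a maximum bisection reveals satisfiability.

Every edge lies among `0, ..., n` and four consecutive chain vertices; these windows are the bags.
The rest is the implementation: a program writes the instance, runs the given algorithm on renamed
variables, and compares the size of the returned cut with four times the number of tokens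
(`outputsWithin_satProgram`), with quadratic overhead (`CNF.HasWidth.overhead_le`). -/

/-- The edges of the gadget with base `c`: for a literal, or (`none`) for the end of a clause. The
vertex `n` represents the truth value `false`. -/
def tokenEdges {n : ℕ} (c : ℕ) : Option (Literal n) → List (ℕ × ℕ)
  | none => [(c, c + 1), (c + 1, c + 2), (c + 2, n), (c + 2, c + 3)]
  | some (x, true) => [(x, c + 1), (c, x), (c, c + 2), (x, c + 2), (c + 2, c + 3)]
  | some (x, false) => [(x, c + 1), (c, c + 1), (c, c + 2), (c + 1, c + 2), (c + 2, c + 3)]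

/-- The edges of a sequence of gadgets, the first one with base `c`. -/
def gadgetEdges {n : ℕ} : ℕ → List (Option (Literal n)) → List (ℕ × ℕ)
  | _, [] => []
  | c, t :: τ => gadgetEdges (c + 3) τ ++ tokenEdges c t

theorem gadgetEdges_append {n : ℕ} (τ τ' : List (Option (Literal n))) (c : ℕ) :
    gadgetEdges c (τ ++ τ') = gadgetEdges (c + 3 * τ.length) τ' ++ gadgetEdges c τ := by
  induction τ generalizing c with
  | nil => simp [gadgetEdges]
  | cons t τ ih =>
    simp only [List.cons_append, gadgetEdges, ih, List.length_cons, List.append_assoc]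
    congr 2; ring

/-- A new last gadget puts its edges in front, as a program does that builds the list with `cons`.
-/
theorem gadgetEdges_concat {n : ℕ} (τ : List (Option (Literal n))) (t : Option (Literal n))
    (c : ℕ) :
    gadgetEdges c (τ ++ [t]) = tokenEdges (c + 3 * τ.length) t ++ gadgetEdges c τ := by
  simp [gadgetEdges_append, gadgetEdges]

/-- The vertices that the gadget with base `c` can touch. -/
def InWindow (n c v : ℕ) : Prop := v ≤ n ∨ c ≤ v ∧ v ≤ c + 3

theorem tokenEdges_inWindow {n c : ℕ} {t : Option (Literal n)} {p : ℕ × ℕ}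
    (hp : p ∈ tokenEdges c t) : InWindow n c p.1 ∧ InWindow n c p.2 := by
  unfold InWindow
  rcases t with _ | ⟨x, _ | _⟩ <;> simp only [tokenEdges, List.mem_cons, List.not_mem_nil,
    or_false] at hp
  · rcases hp with rfl | rfl | rfl | rfl <;> simp only <;> omega
  all_goals
    have := x.2
    rcases hp with rfl | rfl | rfl | rfl | rfl <;> simp only <;> omega

theorem gadgetEdges_inWindow {n c : ℕ} {τ : List (Option (Literal n))} {p : ℕ × ℕ}
    (hp : p ∈ gadgetEdges c τ) :
    ∃ i < τ.length, InWindow n (c + 3 * i) p.1 ∧ InWindow n (c + 3 * i) p.2 := by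
  induction τ generalizing c with
  | nil => simp [gadgetEdges] at hp
  | cons t τ ih =>
    rcases List.mem_append.1 hp with h | h
    · obtain ⟨i, hi, h⟩ := ih h
      refine ⟨i + 1, by simpa using hi, ?_⟩
      rwa [show c + 3 * (i + 1) = c + 3 + 3 * i by ring]
    · exact ⟨0, by simp, by simpa using tokenEdges_inWindow h⟩

theorem tokenEdges_ne {n c : ℕ} (hc : n < c) {t : Option (Literal n)} {p : ℕ × ℕ}
    (hp : p ∈ tokenEdges c t) : p.1 ≠ p.2 := by
  rcases t with _ | ⟨x, _ | _⟩ <;> simp only [tokenEdges, List.mem_cons, List.not_mem_nil,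
    or_false] at hp
  · rcases hp with rfl | rfl | rfl | rfl <;> simp only <;> omega
  all_goals
    have := x.2
    rcases hp with rfl | rfl | rfl | rfl | rfl <;> simp only <;> omega

theorem gadgetEdges_ne {n c : ℕ} (hc : n < c) {τ : List (Option (Literal n))} {p : ℕ × ℕ}
    (hp : p ∈ gadgetEdges c τ) : p.1 ≠ p.2 := by
  induction τ generalizing c with
  | nil => simp [gadgetEdges] at hp
  | cons t τ ih =>
    rcases List.mem_append.1 hp with h | h
    · exact ih (by omega) h
    · exact tokenEdges_ne hc h

/-- The larger end of an edge of the gadget with base `c` is at least `c`, and larger than `c` if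
the other end is not a variable and not `n`. -/
theorem tokenEdges_large {n c : ℕ} {t : Option (Literal n)} {p : ℕ × ℕ}
    (hp : p ∈ tokenEdges c t) :
    (c ≤ p.1 ∨ c ≤ p.2) ∧ (n < p.1 → n < p.2 → c < p.1 ∨ c < p.2) := by
  rcases t with _ | ⟨x, _ | _⟩ <;> simp only [tokenEdges, List.mem_cons, List.not_mem_nil,
    or_false] at hp
  · rcases hp with rfl | rfl | rfl | rfl <;> simp only <;> omega
  all_goals
    have := x.2
    rcases hp with rfl | rfl | rfl | rfl | rfl <;> simp only <;> omega

theorem gadgetEdges_large {n c : ℕ} {τ : List (Option (Literal n))} {p : ℕ × ℕ}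
    (hp : p ∈ gadgetEdges c τ) :
    (c ≤ p.1 ∨ c ≤ p.2) ∧ (n < p.1 → n < p.2 → c < p.1 ∨ c < p.2) := by
  induction τ generalizing c with
  | nil => simp [gadgetEdges] at hp
  | cons t τ ih =>
    rcases List.mem_append.1 hp with h | h
    · have := ih h
      omega
    · exact tokenEdges_large h

theorem tokenEdges_small {n c : ℕ} (hc : n < c) {t : Option (Literal n)} {p : ℕ × ℕ}
    (hp : p ∈ tokenEdges c t) :
    p.1 < c + 3 ∧ p.2 < c + 3 ∨ p = (c + 2, c + 3) := by
  rcases t with _ | ⟨x, _ | _⟩ <;> simp only [tokenEdges, List.mem_cons, List.not_mem_nil,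
    or_false] at hp
  · rcases hp with rfl | rfl | rfl | rfl <;> simp; omega
  all_goals
    have := x.2
    rcases hp with rfl | rfl | rfl | rfl | rfl <;> simp <;> omega

theorem tokenEdges_nodup {n c : ℕ} (hc : n < c) (t : Option (Literal n)) :
    ((tokenEdges c t).map fun p => s(p.1, p.2)).Nodup := by
  rcases t with _ | ⟨x, _ | _⟩
  · simp [tokenEdges]; omega
  all_goals
    have := x.2
    simp [tokenEdges]; omega

/-- Later gadgets start at base `c + 3`, so their edges have an end that is at least `c + 3`. The
only such edge of the gadget at `c` is `(c + 2, c + 3)`. Both of its ends exceed `n`, and a later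
edge of that kind has an end beyond `c + 3`. -/
theorem gadgetEdges_nodup {n c : ℕ} (hc : n < c) (τ : List (Option (Literal n))) :
    ((gadgetEdges c τ).map fun p => s(p.1, p.2)).Nodup := by
  induction τ generalizing c with
  | nil => simp [gadgetEdges]
  | cons t τ ih =>
    rw [gadgetEdges, List.map_append, List.nodup_append]
    refine ⟨ih (by omega), tokenEdges_nodup hc t, ?_⟩
    simp only [List.mem_map]
    rintro _ ⟨⟨a, b⟩, hp, rfl⟩ _ ⟨⟨a', b'⟩, hq, rfl⟩ h
    have h1 := gadgetEdges_large hp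
    have h2 := tokenEdges_small hc hq
    simp only [Sym2.eq_iff, Prod.mk.injEq] at h h1 h2
    omega

/-! ## Cuts of the gadgets -/

/-- The number of edges of `L` that the cut `f` separates. -/
def cutCount (L : List (ℕ × ℕ)) (f : ℕ → Bool) : ℕ := L.countP fun p => f p.1 != f p.2

theorem cutCount_append (L L' : List (ℕ × ℕ)) (f : ℕ → Bool) :
    cutCount (L ++ L') f = cutCount L f + cutCount L' f := List.countP_append ..

theorem cutCount_congr {L : List (ℕ × ℕ)} {f g : ℕ → Bool}
    (h : ∀ p ∈ L, f p.1 = g p.1 ∧ f p.2 = g p.2) : cutCount L f = cutCount L g := by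
  refine List.countP_congr fun p hp => ?_
  rw [(h p hp).1, (h p hp).2]

/-- A literal gadget has five edges, but three of them form a triangle, of which a cut contains at
most two: on `c`, `x`, `c + 2` for a positive literal, on `c`, `c + 1`, `c + 2` for a negative one.
-/
theorem cutCount_tokenEdges_le {n : ℕ} (c : ℕ) (t : Option (Literal n)) (f : ℕ → Bool) :
    cutCount (tokenEdges c t) f ≤ 4 := by
  rcases t with _ | ⟨x, _ | _⟩
  · exact List.countP_le_length
  all_goals
    simp only [cutCount, tokenEdges, List.countP_cons, List.countP_nil]
    generalize f x = fx
    generalize f c = f0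
    generalize f (c + 1) = f1
    generalize f (c + 2) = f2
    generalize f (c + 3) = f3
    revert fx f0 f1 f2 f3
    decide

/-- Every gadget of the sequence has four edges in the cut `f`. -/
def Full {n : ℕ} (f : ℕ → Bool) : ℕ → List (Option (Literal n)) → Prop
  | _, [] => True
  | c, t :: τ => cutCount (tokenEdges c t) f = 4 ∧ Full f (c + 3) τ

theorem cutCount_gadgetEdges_le {n : ℕ} (τ : List (Option (Literal n))) (c : ℕ) (f : ℕ → Bool) :
    cutCount (gadgetEdges c τ) f ≤ 4 * τ.length := by
  induction τ generalizing c with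
  | nil => simp [gadgetEdges, cutCount]
  | cons t τ ih =>
    rw [gadgetEdges, cutCount_append, List.length_cons]
    have := ih (c + 3)
    have := cutCount_tokenEdges_le c t f
    omega

/-- Since no gadget exceeds four, the total reaches `4 * τ.length` only if every gadget attains
four. -/
theorem full_iff {n : ℕ} (τ : List (Option (Literal n))) (c : ℕ) (f : ℕ → Bool) :
    Full f c τ ↔ 4 * τ.length ≤ cutCount (gadgetEdges c τ) f := by
  induction τ generalizing c with
  | nil => simp [Full]
  | cons t τ ih =>
    rw [gadgetEdges, cutCount_append, List.length_cons, Full, ih]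
    have := cutCount_gadgetEdges_le τ (c + 3) f
    have := cutCount_tokenEdges_le c t f
    omega

/-- The meaning of a sequence of tokens: every `none` is preceded by a true literal of its clause,
where `s` tells whether there has been one so far. -/
def Accepts {n : ℕ} (α : Fin n → Bool) : Bool → List (Option (Literal n)) → Prop
  | _, [] => True
  | s, none :: τ => s = true ∧ Accepts α false τ
  | s, some l :: τ => Accepts α (s || α l.1 == l.2) τ

/-- Acceptance only asks for true states. This absorbs the slack of the literal gadgets, where a
full cut may carry a smaller state than the disjunction. -/
theorem Accepts.mono {n : ℕ} {α : Fin n → Bool} {s s' : Bool} {τ : List (Option (Literal n))}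
    (h : Accepts α s τ) (hs : s = true → s' = true) : Accepts α s' τ := by
  induction τ generalizing s s' with
  | nil => trivial
  | cons t τ ih =>
    rcases t with _ | l
    · exact ⟨hs h.1, h.2⟩
    · refine ih h ?_
      simp only [Bool.or_eq_true]
      exact Or.imp_left hs

/-- For an end gadget, the path from `c` to `n` through `c + 1` and `c + 2` alternates sides, so `c`
is opposite to `n`; and `c + 3` is on the side of `n`, both being opposite to `c + 2`. For a literal
gadget, the triangle is not monochromatic. If the state and the literal are both false, `c + 2` is
therefore on the other side, and `c + 3` carries false again; the edge from `x` to `c + 1` makes `c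
+ 1` the negation of `x`. -/
theorem accepts_of_full {n : ℕ} {f : ℕ → Bool} {τ : List (Option (Literal n))} {c : ℕ}
    (h : Full f c τ) : Accepts (fun x => f x ^^ f n) (f c ^^ f n) τ := by
  induction τ generalizing c with
  | nil => trivial
  | cons t τ ih =>
    have h2 := ih h.2
    have h1 := h.1
    rcases t with _ | ⟨x, _ | _⟩
    · simp only [cutCount, tokenEdges, List.countP_cons, List.countP_nil] at h1
      have key : (f c ^^ f n) = true ∧ (f (c + 3) ^^ f n) = false := by
        revert h1
        generalize f n = fn
        generalize f c = f0
        generalize f (c + 1) = f1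
        generalize f (c + 2) = f2
        generalize f (c + 3) = f3
        revert fn f0 f1 f2 f3
        decide
      exact ⟨key.1, key.2 ▸ h2⟩
    all_goals
      refine h2.mono ?_
      simp only [cutCount, tokenEdges, List.countP_cons, List.countP_nil] at h1
      revert h1
      simp only
      generalize f x = fx
      generalize f n = fn
      generalize f c = f0
      generalize f (c + 1) = f1
      generalize f (c + 2) = f2
      generalize f (c + 3) = f3
      revert fn fx f0 f1 f2 f3
      decide

theorem exists_full_of_accepts {n : ℕ} {f : ℕ → Bool} {τ : List (Option (Literal n))} {c : ℕ}
    (hc : n < c) (hn : f n = false) (h : Accepts (fun x : Fin n => f x) (f c) τ) :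
    ∃ g : ℕ → Bool, (∀ v ≤ c, g v = f v) ∧ Full g c τ := by
  induction τ generalizing c f with
  | nil => exact ⟨f, fun _ _ => rfl, trivial⟩
  | cons t τ ih =>
    -- `s` is the largest state allowed after the token. With `c + 1` opposite to `x` in a literal
    -- gadget, and `c + 2` opposite to `c + 3`, four edges are cut.
    let s : Bool := match t with
      | none => false
      | some l => f c || f l.1 == l.2
    let a : Bool := match t with
      | none => false
      | some l => !f l.1
    let f' : ℕ → Bool := fun v =>
      if v ≤ c then f v else if v = c + 1 then a else if v = c + 2 then !s else s
    have hle : ∀ v ≤ c, f' v = f v := fun v hv => if_pos hv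
    have h1 : f' (c + 1) = a := by simp [f']
    have h2 : f' (c + 2) = !s := by simp [f']
    have h3 : f' (c + 3) = s := by simp [f']
    have hα : (fun x : Fin n => f' x) = fun x : Fin n => f x :=
      funext fun x => hle x (by omega)
    have hs : Accepts (fun x : Fin n => f' x) (f' (c + 3)) τ := by
      rw [hα, h3]
      rcases t with _ | l
      · exact h.2
      · exact h
    obtain ⟨g, hg, hfull⟩ := ih (by omega) ((hle n hc.le).trans hn) hs
    refine ⟨g, fun v hv => (hg v (by omega)).trans (hle v hv), ?_, hfull⟩
    have e0 := (hg c (by omega)).trans (hle c le_rfl)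
    have e1 := (hg (c + 1) (by omega)).trans h1
    have e2 := (hg (c + 2) (by omega)).trans h2
    have e3 := (hg (c + 3) (by omega)).trans h3
    have en := ((hg n (by omega)).trans (hle n hc.le)).trans hn
    rcases t with _ | ⟨x, _ | _⟩
    · simp only [cutCount, tokenEdges, List.countP_cons, List.countP_nil, e0, e1, e2, e3, en, h.1,
        a, s]
      decide
    all_goals
      have ex := (hg x (by omega)).trans (hle x (by omega))
      simp only [cutCount, tokenEdges, List.countP_cons, List.countP_nil, e0, e1, e2, e3, ex, a, s]
      generalize f c = f0
      generalize f x = fx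
      revert f0 fx
      decide

/-- The token sequence of a formula. -/
def CNF.tokens {n : ℕ} (φ : CNF n) : List (Option (Literal n)) :=
  none :: φ.flatMap fun c => c.map some ++ [none]

theorem accepts_clause {n : ℕ} (α : Fin n → Bool) (s : Bool) (c : Clause n)
    (τ : List (Option (Literal n))) :
    Accepts α s (c.map some ++ [none] ++ τ) ↔
      (s = true ∨ ∃ l ∈ c, α l.1 = l.2) ∧ Accepts α false τ := by
  induction c generalizing s with
  | nil => simp [Accepts]
  | cons l c ih =>
    simp only [List.map_cons, List.cons_append, Accepts]
    rw [ih]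
    simp [or_assoc]

theorem accepts_tokens {n : ℕ} (α : Fin n → Bool) (φ : CNF n) :
    Accepts α true φ.tokens ↔ ∀ c ∈ φ, ∃ l ∈ c, α l.1 = l.2 := by
  have : ∀ φ : CNF n, Accepts α false (φ.flatMap fun c => c.map some ++ [none]) ↔
      ∀ c ∈ φ, ∃ l ∈ c, α l.1 = l.2 := by
    intro φ
    induction φ with
    | nil => simp [Accepts]
    | cons c φ ih => rw [List.flatMap_cons, accepts_clause, ih]; simp
  simp only [CNF.tokens, Accepts, true_and, this]

/-- A formula is satisfiable if and only if some cut is full on all of its gadgets. -/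
theorem satisfiable_iff_exists_cut {n : ℕ} (φ : CNF n) :
    φ.Satisfiable ↔
      ∃ f : ℕ → Bool, 4 * φ.tokens.length ≤ cutCount (gadgetEdges (n + 1) φ.tokens) f := by
  simp only [← full_iff]
  constructor
  · rintro ⟨α, hα⟩
    -- Off the variables only `n` is false. In particular the first base `n + 1` is true, as the
    -- leading `none` requires; that token resets the state to false before the first clause.
    let f : ℕ → Bool := fun v => if h : v < n then α ⟨v, h⟩ else decide (v ≠ n)
    have hf : (fun x : Fin n => f x) = α := funext fun x => by simp [f]
    obtain ⟨g, -, hg⟩ := exists_full_of_accepts (f := f) (τ := φ.tokens) n.lt_succ_self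
      (by simp [f]) (by rw [hf]; simpa [f] using (accepts_tokens α φ).2 hα)
    exact ⟨g, hg⟩
  · rintro ⟨f, hf⟩
    exact ⟨_, (accepts_tokens _ φ).1 ((accepts_of_full hf).mono fun _ => rfl)⟩

theorem length_tokens_le {n k : ℕ} {φ : CNF n} (h : φ.HasWidth k) :
    φ.tokens.length ≤ (k + 1) * φ.length + 1 := by
  suffices (φ.flatMap fun c => c.map some ++ [none]).length ≤ (k + 1) * φ.length by
    simpa [CNF.tokens]
  induction φ with
  | nil => simp
  | cons c φ ih =>
    have h1 := ih fun c hc => h c (List.mem_cons_of_mem _ hc)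
    have h2 := h c List.mem_cons_self
    rw [List.flatMap_cons, List.length_append]
    simp only [List.length_append, List.length_map, List.length_cons, List.length_nil, mul_add]
    omega

/-! ## The instance of Max Bisection -/

/-- `SimpleGraph.fromEdgeSet` discards loops, so the list describes its graph only if it has none.
-/
theorem mem_edgeList_iff_of_fromEdgeSet {V : Type} {L : List (V × V)} (hne : ∀ p ∈ L, p.1 ≠ p.2)
    (e : Sym2 V) :
    e ∈ (L.map fun p => s(p.1, p.2)) ↔
      e ∈ (SimpleGraph.fromEdgeSet {e | e ∈ L.map fun p => s(p.1, p.2)}).edgeSet := by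
  rw [SimpleGraph.edgeSet_fromEdgeSet]
  refine ⟨fun h => ⟨h, ?_⟩, fun h => h.1⟩
  obtain ⟨p, hp, rfl⟩ := List.mem_map.1 h
  simpa using hne p hp

theorem IsEdgeList.card_edgeSet {V : Type} {G : SimpleGraph V} {L : List (V × V)}
    (h : IsEdgeList G L) : Nat.card G.edgeSet = L.length := by
  classical
  have : G.edgeSet = ((L.map fun p => s(p.1, p.2)).toFinset : Set (Sym2 V)) := by
    ext e; simpa using (h.2 e).symm
  rw [this, Nat.card_coe_set_eq, Set.ncard_coe_finset, List.toFinset_card_of_nodup h.1,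
    List.length_map]

/-- The edges of the path on `q + 1` nodes. -/
def pathEdges (q : ℕ) : List (Fin (q + 1) × Fin (q + 1)) :=
  (List.range q).map fun i => (Fin.ofNat (q + 1) (i + 1), Fin.ofNat (q + 1) i)

theorem isEdgeList_pathEdges (q : ℕ) : IsEdgeList (SimpleGraph.pathGraph (q + 1)) (pathEdges q) := by
  unfold pathEdges
  constructor
  · rw [List.map_map]
    refine List.Nodup.map_on ?_ List.nodup_range
    intro i hi j hj h
    rw [List.mem_range] at hi hj
    simp only [Function.comp, Sym2.eq_iff, Fin.ext_iff, Fin.val_ofNat] at h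
    rw [Nat.mod_eq_of_lt (by omega), Nat.mod_eq_of_lt (by omega), Nat.mod_eq_of_lt (by omega),
      Nat.mod_eq_of_lt (by omega)] at h
    omega
  · intro e
    induction e with
    | _ u v =>
    rw [SimpleGraph.mem_edgeSet, SimpleGraph.pathGraph_adj]
    simp only [List.mem_map, List.mem_range, exists_exists_and_eq_and, Sym2.eq_iff, Fin.ext_iff,
      Fin.val_ofNat]
    constructor
    · rintro ⟨i, hi, h⟩
      rw [Nat.mod_eq_of_lt (by omega), Nat.mod_eq_of_lt (by omega)] at h
      omega
    · rintro (h | h)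
      · refine ⟨u, by omega, ?_⟩
        rw [Nat.mod_eq_of_lt (by omega), Nat.mod_eq_of_lt (by omega)]
        omega
      · refine ⟨v, by omega, ?_⟩
        rw [Nat.mod_eq_of_lt (by omega), Nat.mod_eq_of_lt (by omega)]
        omega

theorem isTree_pathGraph (q : ℕ) : (SimpleGraph.pathGraph (q + 1)).IsTree := by
  rw [SimpleGraph.isTree_iff_connected_and_card, (isEdgeList_pathEdges q).card_edgeSet]
  exact ⟨SimpleGraph.pathGraph_connected q, by simp [pathEdges]⟩

/-- The vertices of the bag of a node of the path. -/
def windowList (n i : ℕ) : List ℕ :=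
  [n + 1 + 3 * i + 3, n + 1 + 3 * i + 2, n + 1 + 3 * i + 1, n + 1 + 3 * i] ++ List.range (n + 1)

theorem mem_windowList {n i v : ℕ} : v ∈ windowList n i ↔ InWindow n (n + 1 + 3 * i) v := by
  simp only [windowList, List.mem_append, List.mem_cons, List.not_mem_nil, or_false,
    List.mem_range, InWindow]
  omega

theorem windowList_nodup (n i : ℕ) : (windowList n i).Nodup := by
  rw [windowList, List.nodup_append]
  refine ⟨by simp, List.nodup_range, ?_⟩
  simp only [List.mem_cons, List.not_mem_nil, or_false, List.mem_range]
  omega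

/-- The largest vertex of the instance with `q + 1` nodes. -/
abbrev lastVertex (n q : ℕ) : ℕ := n + 1 + 3 * (q + 1)

theorem lt_of_inWindow {n q i v : ℕ} (hi : i < q + 1) (hv : InWindow n (n + 1 + 3 * i) v) :
    v < lastVertex n q + 1 := by
  unfold InWindow at hv
  unfold lastVertex
  omega

/-- A vertex of the instance from its number. -/
abbrev toVertex (n q v : ℕ) : Fin (lastVertex n q + 1) := Fin.ofNat _ v

theorem val_toVertex {n q i v : ℕ} (hi : i < q + 1) (hv : InWindow n (n + 1 + 3 * i) v) :
    (toVertex n q v).val = v :=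
  Nat.mod_eq_of_lt (lt_of_inWindow hi hv)

theorem mem_map_toVertex {n q i : ℕ} (hi : i < q + 1) (v : Fin (lastVertex n q + 1)) :
    v ∈ (windowList n i).map (toVertex n q) ↔ InWindow n (n + 1 + 3 * i) v := by
  rw [List.mem_map]
  constructor
  · rintro ⟨u, hu, rfl⟩
    rw [mem_windowList] at hu
    rwa [val_toVertex hi hu]
  · exact fun h => ⟨v, mem_windowList.2 h, Fin.ext (val_toVertex hi h)⟩

/-- The list `L` is the edge list of a simple graph of which every edge lies in one of the first
`q + 1` windows. -/
structure IsWindowed (n q : ℕ) (L : List (ℕ × ℕ)) : Prop where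
  nodup : (L.map fun p => s(p.1, p.2)).Nodup
  ne : ∀ p ∈ L, p.1 ≠ p.2
  window : ∀ p ∈ L, ∃ i < q + 1, InWindow n (n + 1 + 3 * i) p.1 ∧ InWindow n (n + 1 + 3 * i) p.2

/-- An edge as program input, with weight `1`. -/
def encodeEdge (p : ℕ × ℕ) : Val :=
  Val.ofList [Val.ofNat p.1, Val.ofNat p.2, Val.ofList [Val.ofBool true]]

namespace IsWindowed

variable {n q : ℕ} {L : List (ℕ × ℕ)}

/-- The edges as pairs of vertices. -/
abbrev edges (n q : ℕ) (L : List (ℕ × ℕ)) :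
    List (Fin (lastVertex n q + 1) × Fin (lastVertex n q + 1)) :=
  L.map fun p => (toVertex n q p.1, toVertex n q p.2)

/-- The graph of an edge list. -/
abbrev graph (n q : ℕ) (L : List (ℕ × ℕ)) : SimpleGraph (Fin (lastVertex n q + 1)) :=
  SimpleGraph.fromEdgeSet {e | e ∈ (edges n q L).map fun p => s(p.1, p.2)}

theorem val_eq (h : IsWindowed n q L) {p : ℕ × ℕ} (hp : p ∈ L) :
    (toVertex n q p.1).val = p.1 ∧ (toVertex n q p.2).val = p.2 := by
  obtain ⟨i, hi, h1, h2⟩ := h.window p hp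
  exact ⟨val_toVertex hi h1, val_toVertex hi h2⟩

theorem isEdgeList (h : IsWindowed n q L) : IsEdgeList (graph n q L) (edges n q L) := by
  refine ⟨List.Nodup.of_map (Sym2.map Fin.val) ?_, mem_edgeList_iff_of_fromEdgeSet ?_⟩
  · rw [List.map_map, List.map_map]
    convert h.nodup using 1
    refine List.map_congr_left fun p hp => ?_
    simp only [Function.comp, Sym2.map_mk, (h.val_eq hp).1, (h.val_eq hp).2]
  · intro p hp
    obtain ⟨p', hp', rfl⟩ := List.mem_map.1 hp
    intro e
    have := congrArg Fin.val e
    rw [(h.val_eq hp').1, (h.val_eq hp').2] at this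
    exact h.ne p' hp' this

/-- The decomposition along a path, with the windows as bags. -/
def decomp (h : IsWindowed n q L) : TreeDecomposition (graph n q L) (Fin (q + 1)) where
  tree := SimpleGraph.pathGraph (q + 1)
  isTree := isTree_pathGraph q
  root := 0
  bag i := ((windowList n i).map (toVertex n q)).toFinset
  vertex_covered v := by
    simp only [List.mem_toFinset]
    -- For `v ≤ n` the truncated subtraction selects node `0`. The minimum is needed for the last
    -- vertex, where the quotient is `q + 1`.
    refine ⟨⟨min ((v - (n + 1)) / 3) q, by omega⟩, (mem_map_toVertex (by simp) v).2 ?_⟩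
    have := v.2
    unfold lastVertex at this
    unfold InWindow
    simp only
    omega
  edge_covered u v huv := by
    obtain ⟨p, hp, hpe⟩ : ∃ p ∈ L, s(toVertex n q p.1, toVertex n q p.2) = s(u, v) := by
      simpa using huv.1
    obtain ⟨i, hi, h1, h2⟩ := h.window p hp
    refine ⟨⟨i, hi⟩, ?_⟩
    simp only [List.mem_toFinset, mem_map_toVertex hi]
    rw [← (h.val_eq hp).1] at h1
    rw [← (h.val_eq hp).2] at h2
    rcases Sym2.eq_iff.1 hpe with ⟨rfl, rfl⟩ | ⟨rfl, rfl⟩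
    exacts [⟨h1, h2⟩, ⟨h2, h1⟩]
  -- A vertex up to `n` is in all bags. Any other vertex is in at most two windows, and if in two,
  -- then as the end of one and the base of the next, so that their nodes are adjacent.
  bags_connected v := by
    have hset : {i : Fin (q + 1) | v ∈ ((windowList n i).map (toVertex n q)).toFinset} =
        {i : Fin (q + 1) | InWindow n (n + 1 + 3 * i.val) v.val} := by
      ext i; simp only [List.mem_toFinset, Set.mem_ofPred_eq, mem_map_toVertex i.2]
    rw [hset]
    by_cases hv : v.val ≤ n
    · rw [show {i : Fin (q + 1) | InWindow n (n + 1 + 3 * i.val) v.val} = Set.univ from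
        Set.eq_univ_of_forall fun i => Or.inl hv]
      exact (SimpleGraph.induceUnivIso _).connected_iff.2 (SimpleGraph.pathGraph_connected q)
    · have hv2 := v.2
      unfold lastVertex at hv2
      rw [SimpleGraph.connected_iff]
      refine ⟨?_, ⟨⟨min ((v - (n + 1)) / 3) q, by omega⟩, ?_⟩⟩
      · rintro ⟨i, hi⟩ ⟨j, hj⟩
        by_cases hij : i = j
        · subst hij; exact SimpleGraph.Reachable.refl _
        · refine SimpleGraph.Adj.reachable ?_
          rw [SimpleGraph.induce_adj, SimpleGraph.pathGraph_adj]
          simp only [Set.mem_ofPred_eq, InWindow] at hi hj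
          rw [Fin.ext_iff] at hij
          simp only
          omega
      · simp only [Set.mem_ofPred_eq, InWindow]
        omega

theorem width_decomp_le (h : IsWindowed n q L) : h.decomp.width ≤ n + 4 := by
  have : (Finset.univ.sup fun i => (h.decomp.bag i).card) ≤ n + 5 := by
    refine Finset.sup_le fun i _ => (List.toFinset_card_le _).trans ?_
    simp only [windowList, List.length_map, List.length_append, List.length_range, List.length_cons,
      List.length_nil]
    omega
  unfold TreeDecomposition.width
  omega

/-- The instance of Max Bisection with unit weights. -/
def input (h : IsWindowed n q L) : MaxBisectionInput where
  n := lastVertex n q + 1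
  graph := graph n q L
  weight _ := 1
  m := q + 1
  decomp := h.decomp
  edgeList := edges n q L
  isEdgeList := h.isEdgeList
  treeEdgeList := pathEdges q
  isTreeEdgeList := isEdgeList_pathEdges q
  bagList i := (windowList n i).map (toVertex n q)
  bagList_nodup i := by
    refine List.Nodup.map_on ?_ (windowList_nodup n i)
    intro u hu v hv huv
    rw [← val_toVertex i.2 (mem_windowList.1 hu), huv, val_toVertex i.2 (mem_windowList.1 hv)]
  mem_bagList i v := by simp only [decomp, List.mem_toFinset]

/-- This form is free of `Fin` and matches term by term what the program writes. The root `0` is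
encoded by `nil`. -/
theorem encode_input (h : IsWindowed n q L) :
    h.input.encode = Val.ofList [
      Val.ofNat (lastVertex n q + 1),
      Val.ofList (L.map encodeEdge),
      Val.nil,
      Val.ofList ((List.range q).map fun i => Val.cons (Val.ofNat (i + 1)) (Val.ofNat i)),
      Val.ofList ((List.range (q + 1)).map fun i =>
        Val.ofList ((windowList n i).map Val.ofNat))] := by
  have h1 : (edges n q L).map (fun p => Val.ofList [Val.ofNat p.1, Val.ofNat p.2,
      Val.ofNatBinary 1]) = L.map encodeEdge := by
    rw [List.map_map]
    refine List.map_congr_left fun p hp => ?_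
    simp only [Function.comp, (h.val_eq hp).1, (h.val_eq hp).2, encodeEdge, Val.ofNatBinary,
      Nat.one_bits, List.map_cons, List.map_nil]
  have h2 : (pathEdges q).map (fun p => Val.cons (Val.ofNat p.1) (Val.ofNat p.2)) =
      (List.range q).map fun i => Val.cons (Val.ofNat (i + 1)) (Val.ofNat i) := by
    rw [pathEdges, List.map_map]
    refine List.map_congr_left fun i hi => ?_
    rw [List.mem_range] at hi
    simp only [Function.comp, Fin.val_ofNat]
    rw [Nat.mod_eq_of_lt (by omega), Nat.mod_eq_of_lt (by omega)]
  have h3 : List.ofFn (fun i : Fin (q + 1) =>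
        Val.ofList (((windowList n i).map (toVertex n q)).map fun v : Fin _ => Val.ofNat v.val)) =
      (List.range (q + 1)).map fun i => Val.ofList ((windowList n i).map Val.ofNat) := by
    refine List.ext_getElem (by simp) fun i hi _ => ?_
    simp only [List.length_ofFn] at hi
    simp only [List.getElem_ofFn, List.getElem_map, List.getElem_range, List.map_map]
    congr 1
    refine List.map_congr_left fun v hv => ?_
    simp only [Function.comp, val_toVertex hi (mem_windowList.1 hv)]
  simp only [MaxBisectionInput.encode, input, bind_pure_comp, List.map_eq_map,
    List.map_map] at h1 h2 h3 ⊢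
  simp only [Function.comp_def] at h1 h2 h3 ⊢
  rw [h1, h2, h3]
  rfl

/-! ### Weights of cuts, and balancing by isolated vertices -/

theorem weightBetween_eq (h : IsWindowed n q L) (A : Finset (Fin (lastVertex n q + 1))) :
    weightBetween (graph n q L) (fun _ => 1) A Aᶜ =
      cutCount L fun v => decide (toVertex n q v ∈ A) := by
  classical
  let cut : Sym2 (Fin (lastVertex n q + 1)) → Bool := fun e =>
    decide (∃ x ∈ A, ∃ y ∈ Aᶜ, e = s(x, y))
  have hedges : edgesBetween (graph n q L) A Aᶜ =
      (((edges n q L).map fun p => s(p.1, p.2)).filter cut).toFinset := by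
    ext e
    simp only [edgesBetween, Finset.mem_filter, Finset.mem_univ, true_and, List.mem_toFinset,
      List.mem_filter, h.isEdgeList.2 e, cut, decide_eq_true_eq]
  rw [weightBetween, Finset.sum_const, smul_eq_mul, mul_one, hedges,
    List.toFinset_card_of_nodup (h.isEdgeList.1.filter _), ← List.countP_eq_length_filter,
    List.countP_map, List.countP_map, cutCount]
  refine List.countP_congr fun p _ => ?_
  simp only [Function.comp, cut, decide_eq_true_eq, Finset.mem_compl, Sym2.eq_iff, bne_iff_ne, ne_eq,
    decide_eq_decide]
  constructor
  · rintro ⟨x, hx, y, hy, ⟨h1, h2⟩ | ⟨h1, h2⟩⟩ <;> rw [h1, h2] <;> tauto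
  · intro hne
    by_cases h1 : toVertex n q p.1 ∈ A
    · exact ⟨_, h1, _, fun h2 => hne (iff_of_true h1 h2), Or.inl ⟨rfl, rfl⟩⟩
    · exact ⟨_, not_not.1 fun h2 => hne (iff_of_false h1 h2), _, h1, Or.inr ⟨rfl, rfl⟩⟩

/-- Every cut of the first `q + 2` vertices extends to a bisection. -/
theorem exists_isBisection (n q : ℕ) (f : ℕ → Bool) :
    ∃ A : Finset (Fin (lastVertex n q + 1)), IsBisection A Aᶜ ∧
      ∀ v ≤ q + 1, decide (toVertex n q v ∈ A) = f v := by
  let core : Finset (Fin (lastVertex n q + 1)) := Finset.univ.filter fun v => v.val < q + 2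
  have hcore : core.card ≤ q + 2 := by
    refine (Finset.card_le_card_of_injOn Fin.val (t := Finset.range (q + 2)) ?_
      (Fin.val_injective.injOn)).trans (by simp)
    intro v hv
    simpa [core] using hv
  let A₀ := core.filter fun v => f v.val = true
  have h0 : A₀.card ≤ q + 2 := (Finset.card_filter_le _ _).trans hcore
  have h1 : A₀.card ≤ (lastVertex n q + 1) / 2 := by unfold lastVertex; omega
  have h2 : (lastVertex n q + 1) / 2 ≤ (A₀ ∪ coreᶜ).card := by
    have h3 := Finset.card_le_card (Finset.subset_union_right (s₁ := A₀) (s₂ := coreᶜ))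
    rw [Finset.card_compl, Fintype.card_fin] at h3
    unfold lastVertex at h3 ⊢
    omega
  -- At least half of the vertices are outside `core`, so adding some of them to `A₀` reaches
  -- exactly half, rounded down, without changing the cut on `core`.
  obtain ⟨A, hA, hA', hcard⟩ :=
    Finset.exists_subsuperset_card_eq Finset.subset_union_left h1 h2
  refine ⟨A, ⟨isCompl_compl, ?_⟩, fun v hv => ?_⟩
  · rw [Finset.card_compl, Fintype.card_fin, hcard]
    omega
  · have hval : (toVertex n q v).val = v := by
      refine Nat.mod_eq_of_lt ?_
      unfold lastVertex
      omega
    have hvc : toVertex n q v ∈ core :=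
      Finset.mem_filter.2 ⟨Finset.mem_univ _, by rw [hval]; omega⟩
    have key : toVertex n q v ∈ A ↔ f v = true := by
      constructor
      · intro hvA
        rcases Finset.mem_union.1 (hA' hvA) with h | h
        · rw [← hval]; exact (Finset.mem_filter.1 h).2
        · exact absurd hvc (Finset.mem_compl.1 h)
      · intro hf
        exact hA (Finset.mem_filter.2 ⟨hvc, by rwa [hval]⟩)
    rw [Bool.eq_iff_iff, decide_eq_true_iff, key]

end IsWindowed

/-- The edges of the instance for a formula. -/
abbrev CNF.edges {n : ℕ} (φ : CNF n) : List (ℕ × ℕ) := gadgetEdges (n + 1) φ.tokens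

/-- The number of tree edges of the instance for a formula. -/
abbrev CNF.pathLength {n : ℕ} (φ : CNF n) : ℕ := n + 3 * φ.tokens.length

theorem CNF.isWindowed {n : ℕ} (φ : CNF n) : IsWindowed n φ.pathLength φ.edges where
  nodup := gadgetEdges_nodup n.lt_succ_self _
  ne _ hp := gadgetEdges_ne n.lt_succ_self hp
  window _ hp := by
    obtain ⟨i, hi, h⟩ := gadgetEdges_inWindow hp
    exact ⟨i, by unfold CNF.pathLength; omega, h⟩

/-- A cut that is full on all gadgets extends to a bisection of the same size, and a maximum
bisection is at least as large. Conversely, the bisection is itself a cut. -/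
theorem CNF.satisfiable_iff_of_isMaxBisection {n : ℕ} (φ : CNF n)
    {A : Finset (Fin (lastVertex n φ.pathLength + 1))}
    (hA : IsMaxBisection φ.isWindowed.input.graph φ.isWindowed.input.weight A Aᶜ) :
    φ.Satisfiable ↔
      4 * φ.tokens.length ≤ cutCount φ.edges fun v => decide (toVertex n φ.pathLength v ∈ A) := by
  rw [satisfiable_iff_exists_cut]
  refine ⟨?_, fun h => ⟨_, h⟩⟩
  rintro ⟨f, hf⟩
  obtain ⟨B, hB, hBf⟩ := IsWindowed.exists_isBisection n φ.pathLength f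
  have h := hA.2 B Bᶜ hB
  change weightBetween (IsWindowed.graph n φ.pathLength φ.edges) (fun _ => 1) B Bᶜ ≤
    weightBetween (IsWindowed.graph n φ.pathLength φ.edges) (fun _ => 1) A Aᶜ at h
  rw [φ.isWindowed.weightBetween_eq, φ.isWindowed.weightBetween_eq] at h
  refine hf.trans (le_trans (le_of_eq ?_) h)
  refine (cutCount_congr fun p hp => ?_).symm
  obtain ⟨i, hi, h1, h2⟩ := gadgetEdges_inWindow hp
  unfold InWindow at h1 h2
  -- Gadget vertices are at most `n + 1 + 3 * φ.tokens.length = φ.pathLength + 1`, thus within the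
  -- range where `B` agrees with `f`. Only these occur in edges; all windows beyond serve for
  -- padding.
  constructor <;> refine hBf _ ?_ <;> unfold CNF.pathLength <;> omega

/-! ## Running programs -/

/-- The values of the first twelve variables. -/
structure Mem where
  input : Val := Val.nil
  zero : Val := Val.nil
  clauses : Val := Val.nil
  literals : Val := Val.nil
  base : Val := Val.nil
  edges : Val := Val.nil
  target : Val := Val.nil
  counter : Val := Val.nil
  last : Val := Val.nil
  vars : Val := Val.nil
  bags : Val := Val.nil
  tree : Val := Val.nil

namespace Mem

/-- The store in which `m` is followed by the store `s`. -/
def store (m : Mem) (s : Store) : Store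
  | 0 => m.input
  | 1 => m.zero
  | 2 => m.clauses
  | 3 => m.literals
  | 4 => m.base
  | 5 => m.edges
  | 6 => m.target
  | 7 => m.counter
  | 8 => m.last
  | 9 => m.vars
  | 10 => m.bags
  | 11 => m.tree
  | i + 12 => s i

/-- Update of one variable. -/
def set (m : Mem) : ℕ → Val → Mem
  | 0, v => { m with input := v }
  | 1, v => { m with zero := v }
  | 2, v => { m with clauses := v }
  | 3, v => { m with literals := v }
  | 4, v => { m with base := v }
  | 5, v => { m with edges := v }
  | 6, v => { m with target := v }
  | 7, v => { m with counter := v }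
  | 8, v => { m with last := v }
  | 9, v => { m with vars := v }
  | 10, v => { m with bags := v }
  | 11, v => { m with tree := v }
  | _ + 12, _ => m

theorem eq_of_forall {s s' : Store} (h : ∀ i < 12, s i = s' i)
    (h' : ∀ i, s (i + 12) = s' (i + 12)) : s = s' := by
  funext i
  rcases lt_or_ge i 12 with hi | hi
  · exact h i hi
  · obtain ⟨j, rfl⟩ := Nat.exists_eq_add_of_le' hi
    exact h' j

theorem update_store (m : Mem) (s : Store) {x : ℕ} (hx : x < 12) (v : Val) :
    Function.update (m.store s) x v = (m.set x v).store s := by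
  refine eq_of_forall (fun i hi => ?_) fun i => ?_
  · interval_cases x <;> interval_cases i <;> rfl
  · rw [Function.update_of_ne (by omega)]
    interval_cases x <;> rfl

theorem update_store_add (m : Mem) (s : Store) (x : ℕ) (v : Val) :
    Function.update (m.store s) (x + 12) v = m.store (Function.update s x v) := by
  refine eq_of_forall (fun i hi => ?_) fun i => ?_
  · rw [Function.update_of_ne (by omega)]
    interval_cases i <;> rfl
  · change _ = Function.update s x v i
    by_cases h : i = x
    · subst h; simp
    · rw [Function.update_of_ne (by omega), Function.update_of_ne h]
      rfl

end Mem

theorem initStore_eq (x : Val) :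
    initStore x = ({ input := x } : Mem).store fun _ => Val.nil := by
  refine Mem.eq_of_forall (fun i hi => ?_) fun i => ?_
  · interval_cases i <;> rfl
  · exact Function.update_of_ne (by omega) ..

/-- Renaming of variables. -/
def Expr.shift (k : ℕ) : Expr → Expr
  | var x => var (x + k)
  | nil => nil
  | cons a b => cons (a.shift k) (b.shift k)
  | hd a => hd (a.shift k)
  | tl a => tl (a.shift k)

/-- Renaming of variables. -/
def Prog.shift (k : ℕ) : Prog → Prog
  | skip => skip
  | assign x e => assign (x + k) (e.shift k)
  | seq p q => seq (p.shift k) (q.shift k)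
  | ite e p q => ite (e.shift k) (p.shift k) (q.shift k)
  | loop e p => loop (e.shift k) (p.shift k)

theorem Expr.cost_shift (k : ℕ) (e : Expr) : (e.shift k).cost = e.cost := by
  induction e <;> simp_all [Expr.shift, Expr.cost]

theorem Expr.eval_shift (m : Mem) (s : Store) (e : Expr) :
    (e.shift 12).eval (m.store s) = e.eval s := by
  induction e with
  | var x => rfl
  | nil => rfl
  | cons a b iha ihb => simp [Expr.shift, Expr.eval, iha, ihb]
  | hd a ih => simp [Expr.shift, Expr.eval, ih]
  | tl a ih => simp [Expr.shift, Expr.eval, ih]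

/-- After renaming, the given program runs on the variables from `12` on and cannot disturb the
first twelve, which hold the edge list and the target meanwhile. -/
theorem Exec.shift (m : Mem) {p : Prog} {s s' : Store} {t : ℕ} (h : Exec p s t s') :
    Exec (p.shift 12) (m.store s) t (m.store s') := by
  induction h with
  | skip s => exact Exec.skip _
  | assign s x e =>
    rw [← Mem.update_store_add, ← Expr.cost_shift 12, ← Expr.eval_shift m]
    exact Exec.assign _ _ _
  | seq _ _ ih₁ ih₂ => exact Exec.seq ih₁ ih₂
  | iteTrue he _ ih =>
    rw [← Expr.cost_shift 12]
    exact Exec.iteTrue (by rwa [Expr.eval_shift]) ih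
  | iteFalse he _ ih =>
    rw [← Expr.cost_shift 12]
    exact Exec.iteFalse (by rwa [Expr.eval_shift]) ih
  | loopDone he =>
    rw [← Expr.cost_shift 12]
    exact Exec.loopDone (by rwa [Expr.eval_shift])
  | loopStep he _ _ ih₁ ih₂ =>
    rw [← Expr.cost_shift 12]
    exact Exec.loopStep (by rwa [Expr.eval_shift]) ih₁ ih₂

/-- The program `p` changes the first variables from `m` to `m'` within `T` steps and leaves the
others alone. -/
def Runs (s : Store) (p : Prog) (m m' : Mem) (T : ℕ) : Prop :=
  ∃ t ≤ T, Exec p (m.store s) t (m'.store s)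

namespace Runs

variable {s : Store} {p q : Prog} {e : Expr} {m m₁ m₂ : Mem} {T T₁ T₂ : ℕ}

theorem mono (h : Runs s p m m₁ T₁) (hT : T₁ ≤ T₂) : Runs s p m m₁ T₂ :=
  let ⟨t, ht, hex⟩ := h
  ⟨t, ht.trans hT, hex⟩

theorem skip : Runs s Prog.skip m m 1 := ⟨1, le_rfl, Exec.skip _⟩

theorem assign (x : ℕ) (hx : x < 12) (e : Expr) :
    Runs s (Prog.assign x e) m (m.set x (e.eval (m.store s))) (e.cost + 1) :=
  ⟨_, le_rfl, Mem.update_store m s hx _ ▸ Exec.assign _ x e⟩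

theorem seq (h₁ : Runs s p m m₁ T₁) (h₂ : Runs s q m₁ m₂ T₂) :
    Runs s (Prog.seq p q) m m₂ (T₁ + T₂) :=
  let ⟨_, ht₁, hex₁⟩ := h₁
  let ⟨_, ht₂, hex₂⟩ := h₂
  ⟨_, Nat.add_le_add ht₁ ht₂, Exec.seq hex₁ hex₂⟩

theorem iteTrue (he : e.eval (m.store s) ≠ Val.nil) (h : Runs s p m m₁ T) :
    Runs s (Prog.ite e p q) m m₁ (e.cost + 1 + T) :=
  let ⟨_, ht, hex⟩ := h
  ⟨_, Nat.add_le_add_left ht _, Exec.iteTrue he hex⟩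

theorem iteFalse (he : e.eval (m.store s) = Val.nil) (h : Runs s q m m₁ T) :
    Runs s (Prog.ite e p q) m m₁ (e.cost + 1 + T) :=
  let ⟨_, ht, hex⟩ := h
  ⟨_, Nat.add_le_add_left ht _, Exec.iteFalse he hex⟩

theorem loopDone (he : e.eval (m.store s) = Val.nil) :
    Runs s (Prog.loop e p) m m (e.cost + 1) :=
  ⟨_, le_rfl, Exec.loopDone he⟩

theorem loopStep (he : e.eval (m.store s) ≠ Val.nil) (h₁ : Runs s p m m₁ T₁)
    (h₂ : Runs s (Prog.loop e p) m₁ m₂ T₂) :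
    Runs s (Prog.loop e p) m m₂ (e.cost + 1 + T₁ + T₂) :=
  let ⟨_, ht₁, hex₁⟩ := h₁
  let ⟨_, ht₂, hex₂⟩ := h₂
  ⟨_, by omega, Exec.loopStep he hex₁ hex₂⟩

/-- A loop over a list: `S d l` is the state when `d` has been processed and `l` is left. -/
theorem loop_list {α : Type} (P : α → Prop) (S : List α → List α → Mem)
    (hcons : ∀ d a l, e.eval ((S d (a :: l)).store s) ≠ Val.nil)
    (hnil : ∀ d, e.eval ((S d []).store s) = Val.nil)
    (hstep : ∀ d a l, P a → Runs s p (S d (a :: l)) (S (d ++ [a]) l) T) (d l : List α)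
    (hl : ∀ a ∈ l, P a) :
    Runs s (Prog.loop e p) (S d l) (S (d ++ l) [])
      (l.length * (e.cost + 1 + T) + (e.cost + 1)) := by
  induction l generalizing d with
  | nil => simpa using loopDone (hnil d)
  | cons a l ih =>
    have := loopStep (hcons d a l) (hstep d a l (hl a List.mem_cons_self))
      (ih (d ++ [a]) fun b hb => hl b (List.mem_cons_of_mem _ hb))
    rw [List.append_assoc, List.singleton_append] at this
    refine this.mono (le_of_eq ?_)
    rw [List.length_cons]
    ring

/-- A loop that counts down: `S i` is the state when `i` rounds are left. -/
theorem loop_count (S : ℕ → Mem) (k : ℕ)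
    (hsucc : ∀ i, e.eval ((S (i + 1)).store s) ≠ Val.nil)
    (hzero : e.eval ((S 0).store s) = Val.nil)
    (hstep : ∀ i < k, Runs s p (S (i + 1)) (S i) T) :
    Runs s (Prog.loop e p) (S k) (S 0) (k * (e.cost + 1 + T) + (e.cost + 1)) := by
  induction k with
  | zero => simpa using loopDone hzero
  | succ k ih =>
    have := loopStep (hsucc k) (hstep k (Nat.lt_succ_self k)) (ih fun i hi => hstep i (by omega))
    refine this.mono (le_of_eq ?_)
    ring

end Runs

/-! ## The program for the gadgets -/

/-- Successor of a unary numeral. -/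
abbrev Expr.succ (e : Expr) : Expr := Expr.cons Expr.nil e

/-- An edge of weight `1`. -/
abbrev Expr.edge (u v : Expr) : Expr :=
  Expr.cons u (Expr.cons v (Expr.cons (Expr.cons (Expr.cons Expr.nil Expr.nil) Expr.nil) Expr.nil))

/-- Add the edges `es` to the edge list. -/
def addEdges (es : List (Expr × Expr)) : Prog :=
  Prog.assign 5 (es.foldr (fun p l => Expr.cons (Expr.edge p.1 p.2) l) (Expr.var 5))

/-- Move on to the next gadget. -/
def nextGadget : Prog :=
  Prog.seq (Prog.assign 4 (Expr.var 4).succ.succ.succ)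
    (Prog.assign 6 (Expr.var 6).succ.succ.succ.succ)

/-- The gadget for the end of a clause. -/
def emitEnd : Prog :=
  let c := Expr.var 4
  Prog.seq (addEdges [(c, c.succ), (c.succ, c.succ.succ), (c.succ.succ, Expr.var 1),
    (c.succ.succ, c.succ.succ.succ)]) nextGadget

/-- The gadget for the first literal of the current clause. -/
def emitLiteral : Prog :=
  let c := Expr.var 4
  let x := Expr.tl (Expr.hd (Expr.var 3))
  Prog.seq
    (Prog.ite (Expr.hd (Expr.hd (Expr.var 3)))
      (addEdges [(x, c.succ), (c, x), (c, c.succ.succ), (x, c.succ.succ),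
        (c.succ.succ, c.succ.succ.succ)])
      (addEdges [(x, c.succ), (c, c.succ), (c, c.succ.succ), (c.succ, c.succ.succ),
        (c.succ.succ, c.succ.succ.succ)]))
    (Prog.seq (Prog.assign 3 (Expr.tl (Expr.var 3))) nextGadget)

/-- The gadgets of a formula. -/
def emitFormula : Prog :=
  Prog.seq (Prog.assign 1 (Expr.hd (Expr.var 0)))
  (Prog.seq (Prog.assign 2 (Expr.tl (Expr.var 0)))
  (Prog.seq (Prog.assign 4 (Expr.var 1).succ)
  (Prog.seq emitEnd
  (Prog.loop (Expr.var 2)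
    (Prog.seq (Prog.assign 3 (Expr.hd (Expr.var 2)))
    (Prog.seq (Prog.assign 2 (Expr.tl (Expr.var 2)))
    (Prog.seq (Prog.loop (Expr.var 3) emitLiteral) emitEnd)))))))

/-- The state after the gadgets of `τ`. -/
def Mem.afterTokens {n : ℕ} (m : Mem) (τ : List (Option (Literal n))) : Mem :=
  { m with
    base := Val.ofNat (n + 1 + 3 * τ.length)
    edges := Val.ofList ((gadgetEdges (n + 1) τ).map encodeEdge)
    target := Val.ofNat (4 * τ.length) }

theorem Mem.afterTokens_concat {n : ℕ} (m : Mem) (τ : List (Option (Literal n)))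
    (t : Option (Literal n)) :
    m.afterTokens (τ ++ [t]) =
      { m with
        base := Val.ofNat (n + 1 + 3 * τ.length + 3)
        edges := Val.ofList ((tokenEdges (n + 1 + 3 * τ.length) t).map encodeEdge ++
          (gadgetEdges (n + 1) τ).map encodeEdge)
        target := Val.ofNat (4 * τ.length + 4) } := by
  rw [afterTokens, gadgetEdges_concat, List.map_append, List.length_append]
  rfl

/-- A literal as program input. -/
abbrev encodeLiteral {n : ℕ} (l : Literal n) : Val := Val.cons (Val.ofBool l.2) (Val.ofNat l.1)

/-- A clause as program input. -/
abbrev encodeClause {n : ℕ} (c : Clause n) : Val := Val.ofList (c.map encodeLiteral)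

section

variable {n : ℕ} (s : Store) (m : Mem) (τ : List (Option (Literal n)))

theorem runs_emitEnd (hm : m.zero = Val.ofNat n) :
    Runs s emitEnd (m.afterTokens τ) (m.afterTokens (τ ++ [none])) 100 := by
  rw [Mem.afterTokens_concat]
  obtain ⟨_, _, _, _, _, _, _, _, _, _, _, _⟩ := m
  subst hm
  -- With the memory an explicit record, symbolic execution is definitional unfolding: the final
  -- states agree by computation, and only the step count is left to `decide`. The same pattern
  -- recurs for all straight-line code.
  exact ((Runs.assign 5 (by decide) _).seq
    ((Runs.assign 4 (by decide) _).seq (Runs.assign 6 (by decide) _))).mono (by decide)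

theorem runs_emitLiteral (l : Literal n) (v : Val) :
    Runs s emitLiteral ({ m with literals := Val.cons (encodeLiteral l) v }.afterTokens τ)
      ({ m with literals := v }.afterTokens (τ ++ [some l])) 150 := by
  rw [Mem.afterTokens_concat]
  rcases l with ⟨x, _ | _⟩
  · exact ((Runs.iteFalse rfl (Runs.assign 5 (by decide) _)).seq
      ((Runs.assign 3 (by decide) _).seq
        ((Runs.assign 4 (by decide) _).seq (Runs.assign 6 (by decide) _)))).mono (by decide)
  · exact ((Runs.iteTrue (by rintro ⟨⟩) (Runs.assign 5 (by decide) _)).seq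
      ((Runs.assign 3 (by decide) _).seq
        ((Runs.assign 4 (by decide) _).seq (Runs.assign 6 (by decide) _)))).mono (by decide)

theorem runs_emitLiterals (c : Clause n) :
    Runs s (Prog.loop (Expr.var 3) emitLiteral)
      ({ m with literals := encodeClause c }.afterTokens τ)
      ({ m with literals := Val.nil }.afterTokens (τ ++ c.map some)) (c.length * 152 + 2) := by
  have := Runs.loop_list (s := s) (p := emitLiteral) (e := Expr.var 3) (T := 150) (fun _ => True)
    (fun d l => { m with literals := encodeClause l }.afterTokens (τ ++ d.map some))
    (fun _ _ _ => by rintro ⟨⟩) (fun _ => rfl)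
    (fun d a l _ => by
      rw [List.map_append, ← List.append_assoc]
      exact runs_emitLiteral s m _ a _) [] c (by simp)
  simp only [List.map_nil, List.append_nil, List.nil_append] at this
  exact this

theorem runs_emitClauses (hm : m.zero = Val.ofNat n) {k : ℕ} (φ : CNF n) (hφ : φ.HasWidth k) :
    Runs s (Prog.loop (Expr.var 2)
      (Prog.seq (Prog.assign 3 (Expr.hd (Expr.var 2)))
        (Prog.seq (Prog.assign 2 (Expr.tl (Expr.var 2)))
          (Prog.seq (Prog.loop (Expr.var 3) emitLiteral) emitEnd))))
      ({ m with clauses := Val.ofList (φ.map encodeClause), literals := Val.nil }.afterTokens τ)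
      ({ m with clauses := Val.nil, literals := Val.nil }.afterTokens
        (τ ++ φ.flatMap fun c : Clause n => c.map some ++ [none])) (φ.length * (k * 152 + 112) + 2) := by
  have := Runs.loop_list (s := s) (e := Expr.var 2) (T := k * 152 + 110)
    (p := Prog.seq (Prog.assign 3 (Expr.hd (Expr.var 2)))
        (Prog.seq (Prog.assign 2 (Expr.tl (Expr.var 2)))
          (Prog.seq (Prog.loop (Expr.var 3) emitLiteral) emitEnd)))
    (fun c : Clause n => c.length ≤ k)
    (fun d l => { m with clauses := Val.ofList (l.map encodeClause), literals := Val.nil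
        }.afterTokens (τ ++ d.flatMap fun c : Clause n => c.map some ++ [none]))
    (fun _ _ _ => by rintro ⟨⟩) (fun _ => rfl)
    (fun d a l ha => by
      rw [List.flatMap_append, List.flatMap_singleton, ← List.append_assoc, ← List.append_assoc]
      -- Two assignments of cost `3`, the loop over the literals, and the end gadget.
      refine Runs.mono (T₁ := 3 + (3 + ((a.length * 152 + 2) + 100))) ?_ (by nlinarith)
      exact (Runs.assign 3 (by decide) _).seq ((Runs.assign 2 (by decide) _).seq
        ((runs_emitLiterals s { m with clauses := Val.ofList (l.map encodeClause) }
          (τ ++ d.flatMap fun c : Clause n => c.map some ++ [none]) a).seq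
          (runs_emitEnd s _ _ hm)))) [] φ hφ
  simp only [List.flatMap_nil, List.append_nil, List.nil_append] at this
  refine Runs.mono this (le_of_eq ?_)
  simp only [Expr.cost]
  ring

end

theorem runs_emitFormula (s : Store) {n k : ℕ} (φ : CNF n) (hφ : φ.HasWidth k) :
    Runs s emitFormula { input := φ.encode }
      ({ input := φ.encode, zero := Val.ofNat n : Mem }.afterTokens φ.tokens)
      (φ.length * (k * 152 + 112) + 120) := by
  have h1 := runs_emitEnd s (n := n)
    ⟨φ.encode, Val.ofNat n, Val.ofList (φ.map encodeClause), Val.nil, Val.nil, Val.nil, Val.nil,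
      Val.nil, Val.nil, Val.nil, Val.nil, Val.nil⟩ [] rfl
  have h2 := runs_emitClauses s { input := φ.encode, zero := Val.ofNat n } [none] rfl φ hφ
  refine Runs.mono (T₁ := 3 + (3 + (4 + (100 + (φ.length * (k * 152 + 112) + 2))))) ?_ (by omega)
  exact (Runs.assign 1 (by decide) _).seq ((Runs.assign 2 (by decide) _).seq
    ((Runs.assign 4 (by decide) _).seq (h1.seq h2)))

/-! ## The program for the decomposition -/

/-- Raise the last vertex to make room for one more node. -/
def stepLast : Prog :=
  Prog.seq (Prog.assign 7 (Expr.var 7).tl) (Prog.assign 8 (Expr.var 8).succ.succ.succ)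

/-- Add a vertex to the list of those that are in all bags. -/
def stepVars : Prog :=
  Prog.seq (Prog.assign 7 (Expr.var 7).tl) (Prog.assign 9 (Expr.cons (Expr.var 7) (Expr.var 9)))

/-- Add a bag, and the edge to the preceding node if there is one. -/
def stepBags : Prog :=
  let i := Expr.var 7
  let c := Expr.var 8
  Prog.seq (Prog.assign 7 i.tl)
    (Prog.seq (Prog.assign 10 (Expr.cons (Expr.cons c (Expr.cons c.tl (Expr.cons c.tl.tl
        (Expr.cons c.tl.tl.tl (Expr.var 9))))) (Expr.var 10)))
    (Prog.seq (Prog.assign 8 c.tl.tl.tl)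
    (Prog.ite i (Prog.assign 11 (Expr.cons (Expr.cons i i.tl) (Expr.var 11))) Prog.skip)))

/-- The number of vertices, the tree, and the bags, from the number of nodes. -/
def emitDecomposition : Prog :=
  Prog.seq (Prog.assign 7 (Expr.var 4))
  (Prog.seq (Prog.assign 8 (Expr.var 1).succ)
  (Prog.seq (Prog.loop (Expr.var 7) stepLast)
  (Prog.seq (Prog.assign 0 (Expr.var 8).succ)
  (Prog.seq (Prog.assign 7 (Expr.var 1).succ)
  (Prog.seq (Prog.loop (Expr.var 7) stepVars)
  (Prog.seq (Prog.assign 7 (Expr.var 4))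
  (Prog.loop (Expr.var 7) stepBags)))))))

theorem drop_range {k i : ℕ} (h : i < k) :
    (List.range k).drop i = i :: (List.range k).drop (i + 1) := by
  rw [List.drop_eq_getElem_cons (by simpa using h), List.getElem_range]

/-- A bag as program input. -/
abbrev encodeBag (n i : ℕ) : Val := Val.ofList ((windowList n i).map Val.ofNat)

/-- A tree edge as program input. -/
abbrev encodeTreeEdge (i : ℕ) : Val := Val.cons (Val.ofNat (i + 1)) (Val.ofNat i)

section

variable (s : Store) (m : Mem) (n q : ℕ)

theorem runs_emitLast :
    Runs s (Prog.loop (Expr.var 7) stepLast)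
      { m with counter := Val.ofNat q, last := Val.ofNat n }
      { m with counter := Val.nil, last := Val.ofNat (n + 3 * q) } (q * 13 + 2) := by
  have := Runs.loop_count (s := s) (e := Expr.var 7) (T := 11)
    (p := stepLast)
    (fun i => { m with counter := Val.ofNat i, last := Val.ofNat (n + 3 * (q - i)) }) q
    (fun _ => by rintro ⟨⟩) rfl (fun i hi => by
      rw [show q - i = q - (i + 1) + 1 by omega]
      exact (Runs.assign 7 (by decide) _).seq (Runs.assign 8 (by decide) _))
  simp only [Nat.sub_self, Nat.sub_zero] at this
  exact this

theorem runs_emitVars (hm : m.vars = Val.nil) :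
    Runs s (Prog.loop (Expr.var 7) stepVars)
      { m with counter := Val.ofNat q }
      { m with counter := Val.nil, vars := Val.ofList ((List.range q).map Val.ofNat) }
      (q * 9 + 2) := by
  obtain ⟨m0, m1, m2, m3, m4, m5, m6, m7, m8, m9, m10, m11⟩ := m
  subst hm
  have := Runs.loop_count (s := s) (e := Expr.var 7) (T := 7)
    (p := stepVars)
    (fun i => ⟨m0, m1, m2, m3, m4, m5, m6, Val.ofNat i, m8,
      Val.ofList (((List.range q).drop i).map Val.ofNat), m10, m11⟩) q
    (fun _ => by rintro ⟨⟩) rfl (fun i hi => by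
      rw [drop_range hi]
      exact (Runs.assign 7 (by decide) _).seq (Runs.assign 9 (by decide) _))
  simp only [List.drop_zero, List.drop_eq_nil_of_le List.length_range.le] at this
  exact this

theorem runs_emitBags (hm : m.vars = Val.ofList ((List.range (n + 1)).map Val.ofNat))
    (hbags : m.bags = Val.nil) (htree : m.tree = Val.nil) :
    Runs s (Prog.loop (Expr.var 7) stepBags)
      { m with counter := Val.ofNat (q + 1), last := Val.ofNat (n + 1 + 3 * (q + 1)) }
      { m with
        counter := Val.nil
        last := Val.ofNat (n + 1)
        bags := Val.ofList ((List.range (q + 1)).map (encodeBag n))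
        tree := Val.ofList ((List.range q).map encodeTreeEdge) } ((q + 1) * 52 + 2) := by
  obtain ⟨m0, m1, m2, m3, m4, m5, m6, m7, m8, m9, m10, m11⟩ := m
  subst hm hbags htree
  have := Runs.loop_count (s := s) (e := Expr.var 7) (T := 50)
    (p := stepBags)
    (fun i => ⟨m0, m1, m2, m3, m4, m5, m6, Val.ofNat i, Val.ofNat (n + 1 + 3 * i),
      Val.ofList ((List.range (n + 1)).map Val.ofNat),
      Val.ofList (((List.range (q + 1)).drop i).map (encodeBag n)),
      -- Node `i` contributes the edge to node `i - 1`, which has index `i - 1` in the list. At `i =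
      -- 0` the truncated subtraction leaves the list as at `i = 1`, since the first node has no
      -- predecessor.
      Val.ofList (((List.range q).drop (i - 1)).map encodeTreeEdge)⟩) (q + 1)
    (fun _ => by rintro ⟨⟩) rfl (fun i hi => by
      rw [drop_range hi]
      rcases i with _ | i
      · exact ((Runs.assign 7 (by decide) _).seq ((Runs.assign 10 (by decide) _).seq
          ((Runs.assign 8 (by decide) _).seq (Runs.iteFalse rfl Runs.skip)))).mono (by decide)
      · rw [Nat.add_sub_cancel, Nat.add_sub_cancel, drop_range (show i < q by omega)]
        exact ((Runs.assign 7 (by decide) _).seq ((Runs.assign 10 (by decide) _).seq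
          ((Runs.assign 8 (by decide) _).seq (Runs.iteTrue (by rintro ⟨⟩)
            (Runs.assign 11 (by decide) _))))).mono (by decide))
  simp only [Nat.add_sub_cancel, List.drop_zero,
    List.drop_eq_nil_of_le List.length_range.le] at this
  exact this

/-- The number of nodes is read off `base`: after the gadgets it holds `n + 1 + 3 *
φ.tokens.length`, which is `φ.pathLength + 1`. This is the reason for the choice of
`CNF.pathLength`. -/
theorem runs_emitDecomposition (hzero : m.zero = Val.ofNat n) (hbase : m.base = Val.ofNat (q + 1))
    (hvars : m.vars = Val.nil) (hbags : m.bags = Val.nil) (htree : m.tree = Val.nil) :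
    Runs s emitDecomposition m
      { m with
        input := Val.ofNat (lastVertex n q + 1)
        counter := Val.nil
        last := Val.ofNat (n + 1)
        vars := Val.ofList ((List.range (n + 1)).map Val.ofNat)
        bags := Val.ofList ((List.range (q + 1)).map (encodeBag n))
        tree := Val.ofList ((List.range q).map encodeTreeEdge) } (n * 9 + q * 65 + 100) := by
  obtain ⟨_, _, _, _, _, _, _, _, _, _, _, _⟩ := m
  subst hzero hbase hvars hbags htree
  refine Runs.mono (T₁ := 2 + (4 + (((q + 1) * 13 + 2) + (4 + (4 + (((n + 1) * 9 + 2) + (2 +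
    ((q + 1) * 52 + 2)))))))) ?_ (by omega)
  exact (Runs.assign 7 (by decide) _).seq ((Runs.assign 8 (by decide) _).seq
    ((runs_emitLast s ⟨_, _, _, _, _, _, _, _, _, _, _, _⟩ (n + 1) (q + 1)).seq
    ((Runs.assign 0 (by decide) _).seq ((Runs.assign 7 (by decide) _).seq
    ((runs_emitVars s ⟨_, _, _, _, _, _, _, _, _, _, _, _⟩ (n + 1) rfl).seq
    ((Runs.assign 7 (by decide) _).seq
    (runs_emitBags s ⟨_, _, _, _, _, _, _, _, _, _, _, _⟩ n q rfl rfl rfl)))))))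

end

/-! ## The program for the value of a cut -/

/-- Drop as many elements from the list in variable `x` as the counter says. -/
def dropCounter (x : ℕ) : Prog :=
  Prog.loop (Expr.var 7)
    (Prog.seq (Prog.assign 7 (Expr.var 7).tl) (Prog.assign x (Expr.var x).tl))

/-- Decrease the target. -/
def decreaseTarget : Prog := Prog.assign 6 (Expr.var 6).tl

/-- Decrease the target if the first edge of the list is in the cut that variable `12` holds. -/
def countEdge : Prog :=
  let e := Expr.hd (Expr.var 5)
  Prog.seq (Prog.assign 7 e.hd)
  (Prog.seq (Prog.assign 2 (Expr.var 12))
  (Prog.seq (dropCounter 2)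
  (Prog.seq (Prog.assign 7 e.tl.hd)
  (Prog.seq (Prog.assign 3 (Expr.var 12))
  (Prog.seq (dropCounter 3)
  (Prog.seq
    (Prog.ite (Expr.var 2).hd
      (Prog.ite (Expr.var 3).hd Prog.skip decreaseTarget)
      (Prog.ite (Expr.var 3).hd decreaseTarget Prog.skip))
  (Prog.seq (Prog.assign 2 Expr.nil)
  (Prog.seq (Prog.assign 3 Expr.nil)
  (Prog.assign 5 (Expr.var 5).tl)))))))))

/-- Is the number of edges in the cut at least the target? -/
def decideCut : Prog :=
  Prog.seq (Prog.loop (Expr.var 5) countEdge)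
    (Prog.ite (Expr.var 6) (Prog.assign 0 Expr.nil) (Prog.assign 0 Expr.nil.succ))

section

variable (s : Store) (m : Mem)

theorem runs_dropCounter {x : ℕ} (hx : x = 2 ∨ x = 3) (u : ℕ) (v : Val) :
    Runs s (dropCounter x) ({ m with counter := Val.ofNat u }.set x v)
      ({ m with counter := Val.nil }.set x (Val.tl^[u] v)) (u * 8 + 2) := by
  have := Runs.loop_count (s := s) (e := Expr.var 7) (T := 6)
    (p := Prog.seq (Prog.assign 7 (Expr.var 7).tl) (Prog.assign x (Expr.var x).tl))
    (fun i => { m with counter := Val.ofNat i }.set x (Val.tl^[u - i] v)) u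
    (fun _ => by rcases hx with rfl | rfl <;> rintro ⟨⟩) (by rcases hx with rfl | rfl <;> rfl)
    (fun i hi => by
      rw [show u - i = u - (i + 1) + 1 by omega, Function.iterate_succ_apply']
      rcases hx with rfl | rfl <;>
        exact (Runs.assign 7 (by decide) _).seq (Runs.assign _ (by decide) _))
  simp only [Nat.sub_self, Nat.sub_zero, Function.iterate_zero, id_eq] at this
  exact this

/-- The side of a vertex is found by walking down the output list, at a cost linear in `K`. The
scratch variables are `nil` again at the end, so that the step can serve as a loop body. -/
theorem runs_countEdge {f : ℕ → Bool} {K : ℕ}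
    (hf : ∀ v ≤ K, (Val.tl^[v] (s 0)).hd = Val.ofBool (f v))
    (hm : m.clauses = Val.nil) (hm' : m.literals = Val.nil) (hm'' : m.counter = Val.nil)
    (p : ℕ × ℕ) (hp : p.1 ≤ K ∧ p.2 ≤ K) (r : Val) (t : ℕ) :
    Runs s countEdge
      { m with edges := Val.cons (encodeEdge p) r, target := Val.ofNat t }
      { m with
        edges := r
        target := Val.ofNat (t - if f p.1 != f p.2 then 1 else 0) } (K * 16 + 50) := by
  obtain ⟨m0, m1, m2, m3, m4, m5, m6, m7, m8, m9, m10, m11⟩ := m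
  obtain ⟨u, v⟩ := p
  subst hm hm' hm''
  have hu := hf u hp.1
  have hv := hf v hp.2
  have ht : Runs s (Prog.ite (Expr.var 2).hd
      (Prog.ite (Expr.var 3).hd Prog.skip decreaseTarget)
      (Prog.ite (Expr.var 3).hd decreaseTarget Prog.skip))
      ⟨m0, m1, Val.tl^[u] (s 0), Val.tl^[v] (s 0), m4, Val.cons (encodeEdge (u, v)) r, Val.ofNat t,
        Val.nil, m8, m9, m10, m11⟩
      ⟨m0, m1, Val.tl^[u] (s 0), Val.tl^[v] (s 0), m4, Val.cons (encodeEdge (u, v)) r,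
        Val.ofNat (t - if f u != f v then 1 else 0), Val.nil, m8, m9, m10, m11⟩ 10 := by
    have hdec : Runs s decreaseTarget
        ⟨m0, m1, Val.tl^[u] (s 0), Val.tl^[v] (s 0), m4, Val.cons (encodeEdge (u, v)) r,
          Val.ofNat t, Val.nil, m8, m9, m10, m11⟩
        ⟨m0, m1, Val.tl^[u] (s 0), Val.tl^[v] (s 0), m4, Val.cons (encodeEdge (u, v)) r,
          Val.ofNat (t - 1), Val.nil, m8, m9, m10, m11⟩ 3 := by
      have h : Val.ofNat (t - 1) = (Val.ofNat t).tl := by cases t <;> rfl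
      rw [h]
      exact Runs.assign 6 (by decide) _
    have ne : Val.ofBool true ≠ Val.nil := by rintro ⟨⟩
    cases hfu : f u <;> cases hfv : f v <;> rw [hfu] at hu <;> rw [hfv] at hv
    · exact (Runs.iteFalse (by exact hu) (Runs.iteFalse (by exact hv) Runs.skip)).mono (by decide)
    · exact (Runs.iteFalse (by exact hu) (Runs.iteTrue (by exact hv.trans_ne ne) hdec)).mono (by decide)
    · exact (Runs.iteTrue (by exact hu.trans_ne ne) (Runs.iteFalse (by exact hv) hdec)).mono (by decide)
    · exact (Runs.iteTrue (by exact hu.trans_ne ne) (Runs.iteTrue (by exact hv.trans_ne ne) Runs.skip)).mono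
        (by decide)
  simp only at hp
  refine Runs.mono (T₁ := 4 + (2 + ((u * 8 + 2) + (5 + (2 + ((v * 8 + 2) + (10 + (2 + (2 +
    3))))))))) ?_ (by omega)
  exact (Runs.assign 7 (by decide) _).seq ((Runs.assign 2 (by decide) _).seq
    ((runs_dropCounter s ⟨m0, m1, Val.nil, Val.nil, m4, Val.cons (encodeEdge (u, v)) r,
      Val.ofNat t, Val.nil, m8, m9, m10, m11⟩ (Or.inl rfl) u (s 0)).seq
    ((Runs.assign 7 (by decide) _).seq ((Runs.assign 3 (by decide) _).seq
    ((runs_dropCounter s ⟨m0, m1, Val.tl^[u] (s 0), Val.nil, m4, Val.cons (encodeEdge (u, v)) r,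
      Val.ofNat t, Val.nil, m8, m9, m10, m11⟩ (Or.inr rfl) v (s 0)).seq
    (ht.seq ((Runs.assign 2 (by decide) _).seq ((Runs.assign 3 (by decide) _).seq
    (Runs.assign 5 (by decide) _)))))))))

/-- Truncated subtraction decides the comparison: the target, lowered once per cut edge, ends at
zero exactly if the cut has at least `t` edges. -/
theorem runs_decideCut {f : ℕ → Bool} {K : ℕ}
    (hf : ∀ v ≤ K, (Val.tl^[v] (s 0)).hd = Val.ofBool (f v))
    (hm : m.clauses = Val.nil) (hm' : m.literals = Val.nil) (hm'' : m.counter = Val.nil)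
    (L : List (ℕ × ℕ)) (hL : ∀ p ∈ L, p.1 ≤ K ∧ p.2 ≤ K) (t : ℕ) :
    ∃ m' : Mem, m'.input = Val.ofBool (decide (t ≤ cutCount L f)) ∧
      Runs s decideCut { m with edges := Val.ofList (L.map encodeEdge), target := Val.ofNat t } m'
        (L.length * (K * 16 + 52) + 10) := by
  have h := Runs.loop_list (s := s) (p := countEdge) (e := Expr.var 5) (T := K * 16 + 50)
    (fun p : ℕ × ℕ => p.1 ≤ K ∧ p.2 ≤ K)
    (fun d l => { m with
      edges := Val.ofList (l.map encodeEdge), target := Val.ofNat (t - cutCount d f) })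
    (fun _ _ _ => by rintro ⟨⟩) (fun _ => rfl)
    (fun d p l hp => by
      have h1 : t - cutCount (d ++ [p]) f =
          t - cutCount d f - if f p.1 != f p.2 then 1 else 0 := by
        rw [cutCount_append, ← Nat.sub_sub]
        simp [cutCount, List.countP_singleton]
      rw [h1]
      exact runs_countEdge s m hf hm hm' hm'' p hp _ _) [] L hL
  simp only [List.nil_append] at h
  have h2 : Val.ofNat (t - cutCount [] f) = Val.ofNat t := rfl
  rw [h2] at h
  by_cases ht : t ≤ cutCount L f
  · refine ⟨_, ?_, (h.seq (Runs.iteFalse (m₁ := _) ?_ (Runs.assign 0 (by decide) _))).mono ?_⟩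
    · rw [decide_eq_true ht]; rfl
    · change Val.ofNat (t - cutCount L f) = Val.nil
      rw [Nat.sub_eq_zero_of_le ht]; rfl
    · simp only [Expr.cost]; ring_nf; omega
  · refine ⟨_, ?_, (h.seq (Runs.iteTrue (m₁ := _) ?_ (Runs.assign 0 (by decide) _))).mono ?_⟩
    · rw [decide_eq_false ht]; rfl
    · change Val.ofNat (t - cutCount L f) ≠ Val.nil
      obtain ⟨k, hk⟩ := Nat.exists_eq_succ_of_ne_zero (show t - cutCount L f ≠ 0 by omega)
      rw [hk]
      rintro ⟨⟩
    · simp only [Expr.cost]; ring_nf; omega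

end

theorem hd_iterate_tl_ofList (l : List Val) (v : ℕ) :
    (Val.tl^[v] (Val.ofList l)).hd = l.getD v Val.nil := by
  induction l generalizing v with
  | nil =>
    have : Val.tl^[v] Val.nil = Val.nil := Function.iterate_fixed rfl v
    rw [Val.ofList, this]; rfl
  | cons a l ih =>
    rcases v with _ | v
    · rfl
    · exact ih v

theorem hd_iterate_tl_encodeSide {k : ℕ} (A : Finset (Fin (k + 1))) {v : ℕ} (hv : v ≤ k) :
    (Val.tl^[v] (encodeSide A)).hd = Val.ofBool (decide (Fin.ofNat (k + 1) v ∈ A)) := by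
  have hlt : v < k + 1 := by omega
  have hv' : Fin.ofNat (k + 1) v = ⟨v, hlt⟩ := Fin.ext (Nat.mod_eq_of_lt hlt)
  rw [encodeSide, hd_iterate_tl_ofList, List.getD_eq_getElem _ _ (by simpa using hlt),
    List.getElem_ofFn, hv']

/-! ## The algorithm for satisfiability -/

/-- Satisfiability by means of the program `p` for Max Bisection. -/
def satProgram (p : Prog) : Prog :=
  Prog.seq emitFormula
  (Prog.seq emitDecomposition
  (Prog.seq (Prog.assign 12 (Expr.cons (Expr.var 0) (Expr.cons (Expr.var 5) (Expr.cons Expr.nil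
    (Expr.cons (Expr.var 11) (Expr.cons (Expr.var 10) Expr.nil))))))
  (Prog.seq (p.shift 12) decideCut)))

/-- The decidability instance is arbitrary, so that it can be matched with the classical one in
`KSatSolvable`. The summand `12` is the cost of assembling the input of `p`. -/
theorem outputsWithin_satProgram {p : Prog} {n k : ℕ} (φ : CNF n) (hφ : φ.HasWidth k) [Decidable φ.Satisfiable]
    {T : ℝ} (h : SolvesMaxBisection p φ.isWindowed.input T) :
    OutputsWithin (satProgram p) φ.encode (Val.ofBool (decide φ.Satisfiable))
      (((φ.length * (k * 152 + 112) + 120) + (n * 9 + φ.pathLength * 65 + 100) + 12 +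
        (φ.edges.length * (lastVertex n φ.pathLength * 16 + 52) + 10) : ℕ) + T) := by
  obtain ⟨A, hA, t, s, hex, hs, ht⟩ := h
  change Finset (Fin (lastVertex n φ.pathLength + 1)) at A
  obtain ⟨t₁, ht₁, h₁⟩ := runs_emitFormula (fun _ => Val.nil) φ hφ
  obtain ⟨t₂, ht₂, h₂⟩ := runs_emitDecomposition (fun _ => Val.nil)
    (({ input := φ.encode, zero := Val.ofNat n : Mem }).afterTokens φ.tokens) n φ.pathLength rfl
    (by rw [CNF.pathLength, add_right_comm]; rfl) rfl rfl rfl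
  obtain ⟨m', hm', t₃, ht₃, h₃⟩ := runs_decideCut s
    { input := Val.ofNat (lastVertex n φ.pathLength + 1)
      zero := Val.ofNat n
      base := Val.ofNat (n + 1 + 3 * φ.tokens.length)
      last := Val.ofNat (n + 1)
      vars := Val.ofList ((List.range (n + 1)).map Val.ofNat)
      bags := Val.ofList ((List.range (φ.pathLength + 1)).map (encodeBag n))
      tree := Val.ofList ((List.range φ.pathLength).map encodeTreeEdge) }
    (f := fun v => decide (toVertex n φ.pathLength v ∈ A)) (K := lastVertex n φ.pathLength)
    (fun v hv => by rw [hs]; exact hd_iterate_tl_encodeSide A hv) rfl rfl rfl φ.edges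
    (fun q hq => by
      obtain ⟨i, hi, h1, h2⟩ := φ.isWindowed.window q hq
      exact ⟨Nat.le_of_lt_succ (lt_of_inWindow hi h1), Nat.le_of_lt_succ (lt_of_inWindow hi h2)⟩)
    (4 * φ.tokens.length)
  refine ⟨t₁ + (t₂ + (12 + (t + t₃))), m'.store s, ?_, ?_, ?_⟩
  · rw [initStore_eq]
    refine Exec.seq h₁ (Exec.seq h₂ (Exec.seq (Exec.assign _ _ _) (Exec.seq ?_ h₃)))
    -- Seen from variable `12` on, the store is the initial store of `p` with the encoded instance
    -- as input.
    rw [Mem.update_store_add _ _ 0]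
    refine Exec.shift _ ?_
    convert hex using 1
    rw [initStore, φ.isWindowed.encode_input]
    rfl
  · change m'.input = _
    rw [hm']
    congr 1
    exact decide_eq_decide.2 (φ.satisfiable_iff_of_isMaxBisection hA).symm
  · have : t₁ + (t₂ + (12 + t₃)) ≤ (φ.length * (k * 152 + 112) + 120) +
        (n * 9 + φ.pathLength * 65 + 100) + 12 +
        (φ.edges.length * (lastVertex n φ.pathLength * 16 + 52) + 10) := by omega
    have : ((t₁ + (t₂ + (12 + t₃)) : ℕ) : ℝ) ≤ _ := Nat.cast_le.2 this
    push_cast at this ⊢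
    linarith

/-! ### Bounds on the running time -/

theorem length_gadgetEdges_le {n : ℕ} (τ : List (Option (Literal n))) (c : ℕ) :
    (gadgetEdges c τ).length ≤ 5 * τ.length := by
  induction τ generalizing c with
  | nil => simp [gadgetEdges]
  | cons t τ ih =>
    have h1 := ih (c + 3)
    have h2 : (tokenEdges c t).length ≤ 5 := by rcases t with _ | ⟨x, _ | _⟩ <;> simp [tokenEdges]
    rw [gadgetEdges, List.length_append, List.length_cons]
    omega

/-- The factor in the bound for the running time apart from the program for Max Bisection. -/
abbrev overhead (k : ℕ) : ℕ :=
  (152 * k + 232) + (195 * k + 369) + 22 + 5 * (k + 1) * (16 * (9 * k + 16) + 52)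

theorem CNF.HasWidth.length_tokens_le' {n k : ℕ} {φ : CNF n} (hφ : φ.HasWidth k) :
    φ.tokens.length ≤ (k + 1) * (n + φ.length + 1) := by
  refine (length_tokens_le hφ).trans ?_
  nlinarith

theorem CNF.HasWidth.lastVertex_le {n k : ℕ} {φ : CNF n} (hφ : φ.HasWidth k) :
    lastVertex n φ.pathLength + 1 ≤ (9 * k + 17) * (n + φ.length + 1) := by
  have := hφ.length_tokens_le'
  unfold CNF.pathLength lastVertex
  nlinarith

/-- For fixed `k` everything is linear in `n + φ.length + 1`, except the evaluation of the cut,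
where each of linearly many edges costs a walk of linear length. -/
theorem CNF.HasWidth.overhead_le {n k : ℕ} {φ : CNF n} (hφ : φ.HasWidth k) :
    (φ.length * (k * 152 + 112) + 120) + (n * 9 + φ.pathLength * 65 + 100) + 12 +
        (φ.edges.length * (lastVertex n φ.pathLength * 16 + 52) + 10) ≤
      overhead k * (n + φ.length + 1) ^ 2 := by
  have h1 := hφ.length_tokens_le'
  have h2 := hφ.lastVertex_le
  have h3 := length_gadgetEdges_le φ.tokens (n + 1)
  have h4 : φ.pathLength ≤ (3 * k + 4) * (n + φ.length + 1) := by
    unfold CNF.pathLength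
    nlinarith
  have hn : n ≤ n + φ.length + 1 := by omega
  have hm : φ.length ≤ n + φ.length + 1 := by omega
  have hQ : 1 ≤ n + φ.length + 1 := by omega
  have h5 : lastVertex n φ.pathLength ≤ (9 * k + 16) * (n + φ.length + 1) := by
    unfold lastVertex
    nlinarith
  generalize n + φ.length + 1 = Q at *
  have h6 : φ.edges.length * (lastVertex n φ.pathLength * 16 + 52) ≤
      (5 * (k + 1) * Q) * ((16 * (9 * k + 16) + 52) * Q) :=
    Nat.mul_le_mul (by unfold CNF.edges; nlinarith) (by nlinarith)
  have h7 : φ.length * (k * 152 + 112) ≤ Q * (k * 152 + 112) := Nat.mul_le_mul_right _ hm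
  have h8 : (φ.length * (k * 152 + 112) + 120) + (n * 9 + φ.pathLength * 65 + 100) + 12 + 10 ≤
      ((152 * k + 232) + (195 * k + 369) + 22) * Q := by nlinarith
  have h9 : ((152 * k + 232) + (195 * k + 369) + 22) * Q ≤
      ((152 * k + 232) + (195 * k + 369) + 22) * Q ^ 2 :=
    Nat.mul_le_mul_left _ (Nat.le_self_pow two_ne_zero Q)
  calc _ = ((φ.length * (k * 152 + 112) + 120) + (n * 9 + φ.pathLength * 65 + 100) + 12 + 10) +
        φ.edges.length * (lastVertex n φ.pathLength * 16 + 52) := by ring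
    _ ≤ ((152 * k + 232) + (195 * k + 369) + 22) * Q ^ 2 +
        (5 * (k + 1) * Q) * ((16 * (9 * k + 16) + 52) * Q) := add_le_add (h8.trans h9) h6
    _ = overhead k * Q ^ 2 := by unfold overhead; ring

theorem OutputsWithin.mono {p : Prog} {x y : Val} {T T' : ℝ} (h : OutputsWithin p x y T)
    (hT : T ≤ T') : OutputsWithin p x y T' :=
  let ⟨t, s, hex, hs, ht⟩ := h
  ⟨t, s, hex, hs, ht.trans hT⟩

/-- A fast algorithm for Max Bisection gives a fast algorithm for `k`-SAT, for every `k`. -/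
theorem kSatSolvable_of_solvesMaxBisection {a : ℝ} (ha : 0 ≤ a) {p : Prog} {C c : ℕ}
    (hp : ∀ J : MaxBisectionInput, J.IsUnweighted → J.m ≤ J.n →
      SolvesMaxBisection p J (C * a ^ J.decomp.width * (J.n : ℝ) ^ c))
    {b : ℝ} (hab : a ≤ b) (hb : 1 ≤ b) (hb2 : b ≤ 2) (k : ℕ) :
    KSatSolvable k (Real.logb 2 b) := by
  -- The factor `16 = 2 ^ 4` pays for the excess `4` of the width over `n`, and `(9 * k + 17) ^ c`
  -- for the number of vertices compared with `n + φ.length + 1`. The exponent `c + 2` covers both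
  -- `c` and the quadratic overhead.
  refine ⟨satProgram p, overhead k + C * 16 * (9 * k + 17) ^ c, c + 2, fun n φ hφ => ?_⟩
  have hJ := hp φ.isWindowed.input (fun _ _ => rfl) (by
    change φ.pathLength + 1 ≤ lastVertex n φ.pathLength + 1
    unfold lastVertex
    omega)
  refine OutputsWithin.mono (@outputsWithin_satProgram p n k φ hφ (_) _ hJ) ?_
  have hpow : (2 : ℝ) ^ (Real.logb 2 b * n) = b ^ n := by
    rw [Real.rpow_mul two_pos.le, Real.rpow_logb two_pos (by norm_num) (by linarith),
      Real.rpow_natCast]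
  rw [hpow]
  have h1 : (_ : ℝ) ≤ _ := Nat.cast_le.2 hφ.overhead_le
  have h2 : ((lastVertex n φ.pathLength + 1 : ℕ) : ℝ) ≤ _ := Nat.cast_le.2 hφ.lastVertex_le
  have h3 : a ^ φ.isWindowed.input.decomp.width ≤ b ^ n * 16 :=
    calc a ^ φ.isWindowed.input.decomp.width ≤ b ^ φ.isWindowed.input.decomp.width :=
          pow_le_pow_left₀ ha hab _
      _ ≤ b ^ (n + 4) := pow_le_pow_right₀ hb φ.isWindowed.width_decomp_le
      _ = b ^ n * b ^ 4 := pow_add ..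
      _ ≤ b ^ n * 2 ^ 4 := by gcongr
      _ = b ^ n * 16 := by norm_num
  have hQ : (1 : ℝ) ≤ ((n + φ.length + 1 : ℕ) : ℝ) := by
    exact_mod_cast Nat.le_add_left 1 (n + φ.length)
  rw [Nat.cast_mul, Nat.cast_pow] at h1
  rw [Nat.cast_mul] at h2
  generalize ((n + φ.length + 1 : ℕ) : ℝ) = Q at *
  have hbn : (1 : ℝ) ≤ b ^ n := one_le_pow₀ hb
  have h4 : ((overhead k : ℕ) : ℝ) * Q ^ 2 ≤ overhead k * b ^ n * Q ^ (c + 2) := by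
    have := pow_le_pow_right₀ hQ (Nat.le_add_left 2 c)
    calc _ ≤ ((overhead k : ℕ) : ℝ) * Q ^ (c + 2) := by gcongr
      _ = ((overhead k : ℕ) : ℝ) * 1 * Q ^ (c + 2) := by ring
      _ ≤ _ := by gcongr
  have h5 : (C : ℝ) * a ^ φ.isWindowed.input.decomp.width *
      ((lastVertex n φ.pathLength + 1 : ℕ) : ℝ) ^ c ≤
      (C * 16 * (9 * k + 17) ^ c : ℕ) * b ^ n * Q ^ (c + 2) := by
    have := pow_le_pow_right₀ hQ (Nat.le_add_right c 2)
    calc _ ≤ (C : ℝ) * (b ^ n * 16) * (((9 * k + 17 : ℕ) : ℝ) * Q) ^ c := by gcongr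
      _ = (C * 16 * (9 * k + 17) ^ c : ℕ) * b ^ n * Q ^ c := by rw [mul_pow]; push_cast; ring
      _ ≤ _ := by gcongr
  calc _ ≤ _ := add_le_add (h1.trans h4) h5
    _ = _ := by push_cast; ring

end BisectionHardness

/-- If SETH holds, then for no `ε > 0` there is an algorithm for Max Bisection with running time
`(2 - ε) ^ t * n ^ O(1)`, where `n` is the number of vertices and `t` the width of the given tree
decomposition, not even one that is only required to work on inputs with unit weights and with a
decomposition that has at most `n` nodes. -/
theorem mainTheorem3 (hSETH : BisectionHardness.SETH) (ε : ℝ) (hε : 0 < ε) (hε2 : ε < 2) :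
    ¬ ∃ (p : BisectionHardness.Prog) (C c : ℕ), ∀ J : BisectionHardness.MaxBisectionInput,
        J.IsUnweighted → J.m ≤ J.n →
          BisectionHardness.SolvesMaxBisection p J
            (C * (2 - ε) ^ J.decomp.width * (J.n : ℝ) ^ c) := by
  rintro ⟨p, C, c, hp⟩
  -- The maximum with `1` makes powers of the base monotone in the exponent, which is needed because
  -- the width is only bounded from above. The base stays below `2`, so its logarithm is below `1`.
  obtain ⟨k, hk⟩ := hSETH (Real.logb 2 (max (2 - ε) 1)) (by
    rw [Real.logb_lt_iff_lt_rpow one_lt_two (lt_max_of_lt_right one_pos), Real.rpow_one]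
    exact max_lt (by linarith) one_lt_two)
  exact hk (BisectionHardness.kSatSolvable_of_solvesMaxBisection (by linarith) hp
    (le_max_left _ _) (le_max_right _ _) (max_le (by linarith) one_le_two) k)
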